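/- Let $d\ge 1$, equip $[0,1]^d$ with the Euclidean metric, and for Borel probability measures $\mu,\nu$ on $[0,1]^d$ let $\mathcal W(\mu,\nu)=\inf_{\gamma}\int |y-z|\,\gamma(dy,dz)$, the infimum being over all couplings $\gamma$ of $\mu$ and $\nu$. For a Borel probability measure $\pi$ on $[0,1]^d\times[0,1]^d$ with marginals $\pi_1,\pi_2$ and disintegration $\pi(dx_1,dx_2)=\pi_1(dx_1)\,\pi_{x_1}(dx_2)$, put $$\mathcal N(\pi)=\int \mathcal W(\pi_{x_1},\pi_2)\,\pi_1(dx_1),\qquad f(\pi_2)=\iint |y-z|\,\pi_2(dy)\,\pi_2(dz),\qquad \overrightarrow{\mathcal W}(\pi)=\frac{\mathcal N(\pi)}{f(\pi_2)}.$$ Let $r=1/3$ if $d=1$ and $r=1/(2d)$ if $d\ge 2$. For each $N\ge 1$ partition $[0,1]^d$ into $k_N^d$ cubes with edges of length $1/k_N$, where $k_N\geq 1$ is an integer with $|k_N-N^r|<1$ (so $k_N=N^r$ if $N^r$ is an integer), and let $\varphi^N$ be the measurable map that sends each point to the centre of its cube (points on common boundaries may be assigned to any adjacent cube). Given i.i.d.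 samples $(X_1^n,X_2^n)_{n\ge1}$ with law $\pi$, let $$\hat\pi^N=\frac1N\sum_{n=1}^N\delta_{(\varphi^N(X_1^n),\,\varphi^N(X_2^n))}$$ be the adapted empirical measure. Set $$\mathrm{rate}_d(N)=\begin{cases}N^{-1/3}& d=1,\\ N^{-1/4}\log(N+1)& d=2,\\ N^{-1/(2d)}& d\ge 3.\end{cases}$$ Theorem. For every $d\ge1$ and $L\ge 0$ there is a constant $C>0$, depending only on $d$ and $L$, such that the following holds for every $\pi$ which has a version of the disintegration $x_1\mapsto\pi_{x_1}$ that is $L$-Lipschitz from $[0,1]^d$ to $(\mathrm{Prob}([0,1]^d),\mathcal W)$, and for all samples and partitions as above. (1) For all $N\ge1$, $$\mathbb E\,\bigl|\mathcal N(\hat\pi^N)-\mathcal N(\pi)\bigr|\le C\,\mathrm{rate}_d(N).$$ (2) If $f(\pi_2)\ne0$ (that is, $\pi_2$ is not a Dirac mass), then $$\bigl|\overrightarrow{\mathcal W}(\hat\pi^N)-\overrightarrow{\mathcal W}(\pi)\bigr|=O_P\bigl(\mathrm{rate}_d(N)\bigr)\qquad (N\to\infty).$$ In particular the order is $O_P(N^{-1/3})$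 for $d=1$, $O_P(N^{-1/4}\log(N+1))$ for $d=2$, and $O_P(N^{-1/(2d)})$ for $d\ge3$. -/

import Mathlib

open MeasureTheory ProbabilityTheory Filter
open scoped ENNReal NNReal

noncomputable section

namespace WassersteinCorrelation

/-! ### Wasserstein distance and Wasserstein correlation on a metric space -/

section General

variable {α : Type*} [MetricSpace α] [MeasurableSpace α]

/-- The set of couplings of `μ` and `ν`. -/
def couplings (μ ν : Measure α) : Set (Measure (α × α)) :=
  {γ | γ.fst = μ ∧ γ.snd = ν}

/-- The Wasserstein distance (of order one) between `μ` and `ν`. -/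
def wasserstein (μ ν : Measure α) : ℝ≥0∞ :=
  ⨅ γ ∈ couplings μ ν, ∫⁻ p, edist p.1 p.2 ∂γ

/-- The number `∫ W(π_x, π₂) π₁(dx)`, where `x ↦ π_x` is the disintegration of `π` with respect
to its first marginal `π₁`, and `π₂` is its second marginal. -/
def numerator [StandardBorelSpace α] [Nonempty α]
    (π : Measure (α × α)) [IsFiniteMeasure π] : ℝ :=
  (∫⁻ x, wasserstein (π.condKernel x) π.snd ∂π.fst).toReal

/-- The number `f(ν) = ∫∫ d(y, z) ν(dy) ν(dz)`. -/
def meanDist (ν : Measure α) : ℝ :=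
  (∫⁻ y, ∫⁻ z, edist y z ∂ν ∂ν).toReal

/-- The Wasserstein correlation coefficient of `π`. -/
def wassersteinCorrelation [StandardBorelSpace α] [Nonempty α]
    (π : Measure (α × α)) [IsFiniteMeasure π] : ℝ :=
  numerator π / meanDist π.snd

/-- Lipschitz kernels: there is a version `κ` of the disintegration of `π` with respect to its
first marginal such that `x ↦ κ x` is Lipschitz with constant `L`, defined on the whole space,
for the Wasserstein distance. -/
def HasLipschitzKernel (L : ℝ≥0) (π : Measure (α × α)) : Prop :=
  ∃ κ : Kernel α α, IsMarkovKernel κ ∧ π.fst ⊗ₘ κ = π ∧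
    ∀ x y, wasserstein (κ x) (κ y) ≤ L * edist x y

end General

/-! ### The unit cube with the Euclidean metric -/

/-- The cube `[0,1]^d` in Euclidean space. -/
def unitCube (d : ℕ) : Set (EuclideanSpace ℝ (Fin d)) :=
  {x | ∀ i, x i ∈ Set.Icc (0 : ℝ) 1}

theorem isClosed_unitCube (d : ℕ) : IsClosed (unitCube d) := by
  have h : unitCube d = ⋂ i : Fin d, (fun x : EuclideanSpace ℝ (Fin d) => x i) ⁻¹'
      Set.Icc (0 : ℝ) 1 := by
    ext x
    simp [unitCube]
  rw [h]
  exact isClosed_iInter fun i => isClosed_Icc.preimage (by fun_prop)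

instance instStandardBorelUnitCube (d : ℕ) : StandardBorelSpace (unitCube d) :=
  (isClosed_unitCube d).measurableSet.standardBorel

instance instNonemptyUnitCube (d : ℕ) : Nonempty (unitCube d) :=
  ⟨⟨0, fun _ => by simp⟩⟩

/-! ### The adapted empirical measure -/

/-- `φ` is the centre map of a partition of `[0,1]^d` into `k ^ d` cubes with edges of length
`1 / k`: each `x` is sent to the centre of a grid cube whose closure contains `x`. Points that lie
on the boundary of several grid cubes may be assigned to any of them. -/
def IsCenterMap {d : ℕ} (k : ℕ) (φ : unitCube d → unitCube d) : Prop :=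
  Measurable φ ∧ ∀ x : unitCube d, ∃ j : Fin d → Fin k, ∀ i,
    (x : EuclideanSpace ℝ (Fin d)) i ∈ Set.Icc ((j i : ℝ) / k) (((j i : ℝ) + 1) / k) ∧
    (φ x : EuclideanSpace ℝ (Fin d)) i = ((j i : ℝ) + 1 / 2) / k

/-- The exponent `r`. -/
def gridExponent (d : ℕ) : ℝ :=
  if d = 1 then 1 / 3 else 1 / (2 * (d : ℝ))

/-- `φ` is the centre map of a partition into cubes with edges of length `1 / k`, where `k = N ^ r`
if this number is an integer, and otherwise `k` is one of the two neighbouring integers. -/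
def IsAdaptedCenterMap {d : ℕ} (N : ℕ) (φ : unitCube d → unitCube d) : Prop :=
  ∃ k : ℕ, 0 < k ∧ |(k : ℝ) - (N : ℝ) ^ gridExponent d| < 1 ∧ IsCenterMap k φ

/-- The adapted empirical measure of the points `x 0, …, x (N - 1)`. -/
def adaptedEmpirical {d : ℕ} (φ : unitCube d → unitCube d) (N : ℕ)
    (x : ℕ → unitCube d × unitCube d) : Measure (unitCube d × unitCube d) :=
  (N : ℝ≥0∞)⁻¹ • ∑ n ∈ Finset.range N, Measure.dirac (φ (x n).1, φ (x n).2)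

instance instFiniteAdaptedEmpirical {d : ℕ} (φ : unitCube d → unitCube d) (N : ℕ)
    (x : ℕ → unitCube d × unitCube d) :
    IsFiniteMeasure (adaptedEmpirical φ N x) := by
  rcases Nat.eq_zero_or_pos N with rfl | hN
  · simp only [adaptedEmpirical, Finset.range_zero, Finset.sum_empty, smul_zero]
    infer_instance
  · exact Measure.smul_finite _ (ENNReal.inv_ne_top.2 (by exact_mod_cast hN.ne'))

/-! ### Samples, rates, and boundedness in probability -/

/-- `X 0, X 1, …` are independent with common law `π`. -/
def IsIIDSample {Ω β : Type*} [MeasurableSpace Ω] [MeasurableSpace β] (P : Measure Ω)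
    (π : Measure β) (X : ℕ → Ω → β) : Prop :=
  (∀ n, Measurable (X n)) ∧ iIndepFun X P ∧ ∀ n, P.map (X n) = π

/-- The rate of convergence in dimension `d ≥ 1`. -/
def rate (d N : ℕ) : ℝ :=
  if d = 1 then (N : ℝ) ^ (-(1 / 3) : ℝ)
  else if d = 2 then (N : ℝ) ^ (-(1 / 4) : ℝ) * Real.log ((N : ℝ) + 1)
  else (N : ℝ) ^ (-(1 / (2 * (d : ℝ))))

/-- `Z N = O_P(a N)` as `N → ∞`. -/
def IsBigOP {Ω : Type*} [MeasurableSpace Ω] (P : Measure Ω) (Z : ℕ → Ω → ℝ) (a : ℕ → ℝ) : Prop :=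
  ∀ ε : ℝ, 0 < ε → ∃ M : ℝ, 0 < M ∧
    ∀ᶠ N in atTop, P {ω | M * a N < |Z N ω|} ≤ ENNReal.ofReal ε

end WassersteinCorrelation

end

open WassersteinCorrelation

/-!
The Wasserstein distance is used for finite measures of equal mass, not only for probability
measures: there it is subadditive, homogeneous, and satisfies the triangle inequality
(`wasserstein_triangle`). Let `κ` be the Lipschitz version of the disintegration of `π`, and let
`π₂` be the second marginal.

For the adapted empirical measure `ρ`, the numerator is the mean over the sample of
`W(ρ_{φ(x₁)}, ρ₂)`. By the triangle inequality and the Lipschitz property of `κ`, its difference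
from `∫ W(κ_{x₁}, π₂) dπ` consists of four parts (`abs_numerator_sub_le`): the fluctuation of the
sample mean of the bounded function `W(κ_{x₁}, π₂)`, of order `N ^ (-1/2)`; the effect of
rounding, of order `1 / k`; the distance between `ρ₂` and `π₂`; and the sum, over the cells `g` of
the grid, of the distances between the unnormalized measures `(1/N) ∑ δ_{x₂}` and
`(1/N) ∑ κ_{x₁}`, where the sums run over the sample points with `x₁` in `g`.

The last two parts are treated alike. A multiscale bound (`IsRefiningScheme.wasserstein_le`)
estimates `W(μ, ν)` by the sum over the dyadic scales `2 ^ (-i)`, `i < J`, of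
`2 ^ (-i) ∑_Q |μ(Q) - ν(Q)|`, with `Q` running over the dyadic cubes of level `i + 1`, plus a term
of order `2 ^ (-J)`. The difference of the masses of `Q` is the sample mean of the function
`1_g(x₁) (1_Q(x₂) - κ_{x₁}(Q))`. This function has mean zero under `π` and a second moment of at
most `2 π(g × Q)`, so that no conditioning on the first coordinates is needed: the expected
modulus of the sample mean is at most `(2 π(g × Q) / N) ^ (1/2)`, and by the Cauchy–Schwarz
inequality the sum over all `g` and `Q` is at most the square root of twice the number of pairs
`(g, Q)` divided by `N` (`integral_cellBound_le`). With `2 ^ J` of the order of `k`, the sum over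
the scales is geometric, decreasing for `d = 1`, constant for `d = 2` and increasing for `d ≥ 3`,
which gives the three rates (`sum_scales_le`).

For the correlation coefficient, the mean distance is Lipschitz for the Wasserstein distance
(`abs_meanDist_sub_le`), and the numerator is at most the mean distance (`numerator_le_meanDist`).
Hence the error of the quotient is at most the sum of the two errors divided by the mean distance
of `π₂` (`abs_div_sub_div_le`), and Markov's inequality applies.
-/

namespace WassersteinCorrelation

/-! ### The Wasserstein distance between finite measures -/

section Wasserstein

variable {α : Type*} [MetricSpace α] [MeasurableSpace α]

theorem wasserstein_le_of_coupling {μ ν : Measure α} {γ : Measure (α × α)} (h₁ : γ.fst = μ)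
    (h₂ : γ.snd = ν) : wasserstein μ ν ≤ ∫⁻ p, edist p.1 p.2 ∂γ :=
  iInf₂_le γ ⟨h₁, h₂⟩

theorem wasserstein_zero_zero : wasserstein (0 : Measure α) 0 = 0 :=
  le_antisymm ((wasserstein_le_of_coupling (γ := 0) (by simp) (by simp)).trans (by simp)) bot_le

theorem wasserstein_add_le (μ₁ μ₂ ν₁ ν₂ : Measure α) :
    wasserstein (μ₁ + μ₂) (ν₁ + ν₂) ≤ wasserstein μ₁ ν₁ + wasserstein μ₂ ν₂ := by
  refine ENNReal.le_iInf₂_add_iInf₂ ?_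
  rintro γ₁ ⟨h₁, h₂⟩ γ₂ ⟨h₃, h₄⟩
  refine (wasserstein_le_of_coupling (γ := γ₁ + γ₂) ?_ ?_).trans_eq ?_
  · rw [Measure.fst_add, h₁, h₃]
  · rw [Measure.snd_add, h₂, h₄]
  · rw [lintegral_add_measure]

theorem wasserstein_sum_le {ι : Type*} (s : Finset ι) (μ ν : ι → Measure α) :
    wasserstein (∑ i ∈ s, μ i) (∑ i ∈ s, ν i) ≤ ∑ i ∈ s, wasserstein (μ i) (ν i) := by
  classical
  induction s using Finset.induction_on with
  | empty => simp [wasserstein_zero_zero]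
  | insert a s ha ih =>
    rw [Finset.sum_insert ha, Finset.sum_insert ha, Finset.sum_insert ha]
    exact (wasserstein_add_le _ _ _ _).trans (by gcongr)

theorem wasserstein_smul_le {c : ℝ≥0∞} (hc : c ≠ ∞) (μ ν : Measure α) :
    wasserstein (c • μ) (c • ν) ≤ c * wasserstein μ ν := by
  rcases eq_or_ne c 0 with rfl | h0
  · simp [wasserstein_zero_zero]
  · unfold wasserstein
    simp only [ENNReal.mul_iInf_of_ne h0 hc]
    refine le_iInf₂ fun γ hγ => ?_
    refine (wasserstein_le_of_coupling (γ := c • γ) ?_ ?_).trans_eq ?_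
    · rw [Measure.fst, Measure.map_smul, ← Measure.fst, hγ.1]
    · rw [Measure.snd, Measure.map_smul, ← Measure.snd, hγ.2]
    · rw [lintegral_smul_measure, smul_eq_mul]

theorem mul_wasserstein_le {c : ℝ≥0∞} (hc : c ≠ ∞) (μ ν : Measure α) :
    c * wasserstein μ ν ≤ wasserstein (c • μ) (c • ν) := by
  rcases eq_or_ne c 0 with rfl | h0
  · simp
  · have h := wasserstein_smul_le (ENNReal.inv_ne_top.2 h0) (c • μ) (c • ν)
    rw [smul_smul, smul_smul, ENNReal.inv_mul_cancel h0 hc, one_smul, one_smul] at h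
    calc c * wasserstein μ ν ≤ c * (c⁻¹ * wasserstein (c • μ) (c • ν)) := by gcongr
      _ = wasserstein (c • μ) (c • ν) := by
        rw [← mul_assoc, ENNReal.mul_inv_cancel h0 hc, one_mul]

variable [BorelSpace α] [SecondCountableTopology α]

theorem wasserstein_map_le {β : Type*} [MeasurableSpace β] (μ : Measure β) {f g : β → α}
    (hf : Measurable f) (hg : Measurable g) :
    wasserstein (μ.map f) (μ.map g) ≤ ∫⁻ x, edist (f x) (g x) ∂μ := by
  refine (wasserstein_le_of_coupling (γ := μ.map fun x => (f x, g x)) ?_ ?_).trans_eq ?_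
  · rw [Measure.fst_map_prodMk hg]
  · rw [Measure.snd_map_prodMk hf]
  · rw [lintegral_map measurable_edist (hf.prodMk hg)]

theorem wasserstein_self (μ : Measure α) : wasserstein μ μ = 0 := by
  refine le_antisymm ?_ bot_le
  simpa using wasserstein_map_le μ measurable_id measurable_id

theorem wasserstein_self_map_le (μ : Measure α) {T : α → α} (hT : Measurable T) {δ : ℝ≥0∞}
    (h : ∀ x, edist (T x) x ≤ δ) : wasserstein μ (μ.map T) ≤ δ * μ Set.univ := by
  have := wasserstein_map_le μ measurable_id hT
  rw [Measure.map_id] at this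
  refine this.trans ?_
  calc ∫⁻ x, edist (id x) (T x) ∂μ ≤ ∫⁻ _, δ ∂μ :=
        lintegral_mono fun x => by rw [edist_comm]; exact h x
    _ = δ * μ Set.univ := by simp

theorem wasserstein_comm (μ ν : Measure α) : wasserstein μ ν = wasserstein ν μ := by
  have key : ∀ μ ν : Measure α, wasserstein μ ν ≤ wasserstein ν μ := fun μ ν => by
    refine le_iInf₂ fun γ hγ => ?_
    refine (wasserstein_le_of_coupling (γ := γ.map Prod.swap) ?_ ?_).trans_eq ?_
    · rw [Measure.fst_map_swap, hγ.2]
    · rw [Measure.snd_map_swap, hγ.1]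
    · rw [lintegral_map measurable_edist measurable_swap]
      simp [edist_comm]
  exact le_antisymm (key _ _) (key _ _)

/-- The product coupling bounds the distance between probability measures. -/
theorem wasserstein_le_lintegral_lintegral (μ ν : Measure α) [IsProbabilityMeasure μ]
    [IsProbabilityMeasure ν] : wasserstein μ ν ≤ ∫⁻ y, ∫⁻ z, edist y z ∂ν ∂μ := by
  refine (wasserstein_le_of_coupling (γ := μ.prod ν) (by simp) (by simp)).trans_eq ?_
  rw [lintegral_prod _ measurable_edist.aemeasurable]

theorem wasserstein_le_of_edist_le (μ ν : Measure α) [IsProbabilityMeasure μ]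
    [IsProbabilityMeasure ν] {D : ℝ≥0∞} (hD : ∀ x y : α, edist x y ≤ D) : wasserstein μ ν ≤ D := by
  refine (wasserstein_le_lintegral_lintegral μ ν).trans ?_
  calc ∫⁻ y, ∫⁻ z, edist y z ∂ν ∂μ ≤ ∫⁻ _, ∫⁻ _, D ∂ν ∂μ :=
        lintegral_mono fun y => lintegral_mono fun z => hD y z
    _ = D := by simp

/-- The triangle inequality. Two couplings with a common marginal are glued along it: the second
one is disintegrated with respect to the common marginal and composed with the first one. -/
theorem wasserstein_triangle [StandardBorelSpace α] [Nonempty α] (μ ν ρ : Measure α)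
    [IsFiniteMeasure μ] [IsFiniteMeasure ν] :
    wasserstein μ ρ ≤ wasserstein μ ν + wasserstein ν ρ := by
  refine ENNReal.le_iInf₂_add_iInf₂ ?_
  rintro γ₁ ⟨h₁, h₂⟩ γ₂ ⟨h₃, h₄⟩
  have : IsFiniteMeasure γ₁ := ⟨by
    rw [← Measure.fst_univ, h₁]; exact measure_lt_top _ _⟩
  have : IsFiniteMeasure γ₂ := ⟨by
    rw [← Measure.fst_univ, h₃]; exact measure_lt_top _ _⟩
  set Θ : Measure ((α × α) × α) := γ₁ ⊗ₘ (Kernel.prodMkLeft α γ₂.condKernel) with hΘ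
  have hfst : Θ.fst = γ₁ := Measure.fst_compProd _ _
  have hm : Measurable fun p : (α × α) × α => (p.1.2, p.2) := by fun_prop
  have hsnd : Θ.map (fun p => (p.1.2, p.2)) = γ₂ := by
    refine Measure.ext_of_lintegral _ fun f hf => ?_
    conv_rhs => rw [← γ₂.disintegrate γ₂.condKernel, h₃, ← h₂]
    rw [lintegral_map hf hm, hΘ,
      Measure.lintegral_compProd (f := fun p : (α × α) × α => f (p.1.2, p.2)) (hf.comp hm),
      Measure.lintegral_compProd hf, Measure.snd,
      lintegral_map (hf.lintegral_kernel_prod_right') measurable_snd]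
    rfl
  have hm' : Measurable fun p : (α × α) × α => (p.1.1, p.2) := by fun_prop
  refine (wasserstein_le_of_coupling (γ := Θ.map fun p => (p.1.1, p.2)) ?_ ?_).trans ?_
  · rw [Measure.fst_map_prodMk (by fun_prop), ← h₁, ← hfst, Measure.fst, Measure.fst,
      Measure.map_map measurable_fst measurable_fst]
    rfl
  · rw [Measure.snd_map_prodMk (by fun_prop), ← h₄, ← hsnd, Measure.snd_map_prodMk (by fun_prop)]
  · rw [lintegral_map measurable_edist hm']
    calc ∫⁻ p, edist p.1.1 p.2 ∂Θ
        ≤ ∫⁻ p, edist p.1.1 p.1.2 + edist p.1.2 p.2 ∂Θ :=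
          lintegral_mono fun p => edist_triangle _ _ _
      _ = ∫⁻ p, edist p.1.1 p.1.2 ∂Θ + ∫⁻ p, edist p.1.2 p.2 ∂Θ :=
          lintegral_add_left (by fun_prop) _
      _ = ∫⁻ p, edist p.1 p.2 ∂γ₁ + ∫⁻ p, edist p.1 p.2 ∂γ₂ := by
        conv_rhs => rw [← hfst, ← hsnd]
        rw [Measure.fst, lintegral_map measurable_edist measurable_fst,
          lintegral_map measurable_edist hm]

/-- The mean distance is Lipschitz: couple the first and the second variable separately. -/
theorem lintegral_edist_le_add_wasserstein (μ ν : Measure α) [IsProbabilityMeasure μ]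
    [IsProbabilityMeasure ν] :
    ∫⁻ y, ∫⁻ z, edist y z ∂μ ∂μ
      ≤ ∫⁻ y, ∫⁻ z, edist y z ∂ν ∂ν + (wasserstein μ ν + wasserstein μ ν) := by
  rw [← tsub_le_iff_left]
  refine ENNReal.le_iInf₂_add_iInf₂ ?_
  rintro γ₁ ⟨h₁, h₂⟩ γ₂ ⟨h₃, h₄⟩
  rw [tsub_le_iff_left]
  have : IsProbabilityMeasure γ₁ := ⟨by rw [← Measure.fst_univ, h₁]; exact measure_univ⟩
  have : IsProbabilityMeasure γ₂ := ⟨by rw [← Measure.fst_univ, h₃]; exact measure_univ⟩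
  have e₁ : ∫⁻ y, ∫⁻ z, edist y z ∂μ ∂μ = ∫⁻ p, ∫⁻ q, edist p.1 q.1 ∂γ₂ ∂γ₁ := by
    rw [← lintegral_prod _ measurable_edist.aemeasurable]
    rw [← lintegral_prod (μ := γ₁) (ν := γ₂) (fun r => edist r.1.1 r.2.1) (by fun_prop)]
    have : μ.prod μ = (γ₁.prod γ₂).map (Prod.map Prod.fst Prod.fst) := by
      rw [← Measure.map_prod_map _ _ measurable_fst measurable_fst, ← Measure.fst, ← Measure.fst,
        h₁, h₃]
    rw [this, lintegral_map measurable_edist (by fun_prop)]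
    rfl
  have e₂ : ∫⁻ y, ∫⁻ z, edist y z ∂ν ∂ν = ∫⁻ p, ∫⁻ q, edist p.2 q.2 ∂γ₂ ∂γ₁ := by
    rw [← lintegral_prod _ measurable_edist.aemeasurable]
    rw [← lintegral_prod (μ := γ₁) (ν := γ₂) (fun r => edist r.1.2 r.2.2) (by fun_prop)]
    have : ν.prod ν = (γ₁.prod γ₂).map (Prod.map Prod.snd Prod.snd) := by
      rw [← Measure.map_prod_map _ _ measurable_snd measurable_snd, ← Measure.snd, ← Measure.snd,
        h₂, h₄]
    rw [this, lintegral_map measurable_edist (by fun_prop)]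
    rfl
  rw [e₁, e₂]
  calc ∫⁻ p, ∫⁻ q, edist p.1 q.1 ∂γ₂ ∂γ₁
      ≤ ∫⁻ p, ∫⁻ q, (edist p.2 q.2 + (edist p.1 p.2 + edist q.1 q.2)) ∂γ₂ ∂γ₁ := by
        refine lintegral_mono fun p => lintegral_mono fun q => ?_
        calc edist p.1 q.1 ≤ edist p.1 p.2 + edist p.2 q.2 + edist q.2 q.1 :=
              edist_triangle4 _ _ _ _
          _ = _ := by rw [edist_comm q.2 q.1]; ring
    _ = ∫⁻ p, (∫⁻ q, edist p.2 q.2 ∂γ₂ + (edist p.1 p.2 + ∫⁻ q, edist q.1 q.2 ∂γ₂)) ∂γ₁ := by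
        refine lintegral_congr fun p => ?_
        rw [lintegral_add_left (by fun_prop), lintegral_add_left (by fun_prop)]
        simp
    _ = _ := by
        rw [lintegral_add_right _ (by fun_prop), lintegral_add_left (by fun_prop)]
        simp

end Wasserstein

/-! ### The multiscale bound for the Wasserstein distance -/

/-- The distance `|a - b|`, for extended nonnegative real numbers. -/
def absDiff (a b : ℝ≥0∞) : ℝ≥0∞ := (a - b) + (b - a)

theorem absDiff_add_left {c : ℝ≥0∞} (hc : c ≠ ∞) (a b : ℝ≥0∞) :
    absDiff (c + a) (c + b) = absDiff a b := by
  unfold absDiff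
  rw [ENNReal.add_sub_add_eq_sub_left hc, ENNReal.add_sub_add_eq_sub_left hc]

theorem absDiff_ofReal {a b : ℝ} (ha : 0 ≤ a) (hb : 0 ≤ b) :
    absDiff (ENNReal.ofReal a) (ENNReal.ofReal b) = ENNReal.ofReal |a - b| := by
  unfold absDiff
  rw [← ENNReal.ofReal_sub _ hb, ← ENNReal.ofReal_sub _ ha]
  rcases le_total a b with h | h
  · rw [ENNReal.ofReal_of_nonpos (sub_nonpos.2 h), zero_add, abs_sub_comm,
      abs_of_nonneg (sub_nonneg.2 h)]
  · rw [ENNReal.ofReal_of_nonpos (sub_nonpos.2 h), add_zero, abs_of_nonneg (sub_nonneg.2 h)]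

/-- A refining sequence of finite partitions of `α`, each given by a map that sends every point to
a marked point of its cell: `T l` has values in the finite set `S l` and moves points by at most
`δ l`, a point and the marked point of its cell of level `l + 1` are in the same cell of level `l`,
and there is only one cell at level `0`. -/
structure IsRefiningScheme {α : Type*} [MetricSpace α] [MeasurableSpace α] (T : ℕ → α → α)
    (S : ℕ → Finset α) (δ : ℕ → ℝ≥0∞) : Prop where
  measurable : ∀ l, Measurable (T l)
  mem : ∀ l x, T l x ∈ S l
  comp_succ : ∀ l x, T l (T (l + 1) x) = T l x
  zero : ∀ x y, T 0 x = T 0 y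
  edist_le : ∀ l x, edist (T l x) x ≤ δ l

section Multiscale

variable {α : Type*} [MetricSpace α] [MeasurableSpace α]

theorem IsRefiningScheme.comp_of_le {T : ℕ → α → α} {S : ℕ → Finset α} {δ : ℕ → ℝ≥0∞}
    (h : IsRefiningScheme T S δ) {i l : ℕ} (hil : i < l) (x : α) : T i (T l x) = T i x := by
  induction l, hil using Nat.le_induction generalizing x with
  | base => exact h.comp_succ i x
  | succ l hl ih => rw [← ih (T (l + 1) x), h.comp_succ, ih]

variable [BorelSpace α] [SecondCountableTopology α]

theorem map_eq_sum_smul_dirac (μ : Measure α) (S : Finset α) {T : α → α} (hT : Measurable T)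
    (hS : ∀ x, T x ∈ S) :
    μ.map T = ∑ y ∈ S, μ (T ⁻¹' {y}) • Measure.dirac y := by
  ext s hs
  rw [Measure.map_apply hT hs, Measure.finsetSum_apply]
  classical
  have : T ⁻¹' s = ⋃ y ∈ S.filter (· ∈ s), T ⁻¹' {y} := by
    ext x
    simp [hS]
  rw [this, measure_biUnion_finset]
  · rw [Finset.sum_filter]
    refine Finset.sum_congr rfl fun y _ => ?_
    by_cases hy : y ∈ s <;> simp [hy, hs]
  · intro y _ z _ hyz
    exact Disjoint.preimage T (Set.disjoint_singleton.2 hyz)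
  · exact fun y _ => hT (measurableSet_singleton y)

/-- The multiscale bound between the images of `μ` and `ν` at a given level. The mass that the two
measures have in common at level `l + 1` stays in place, and the remaining masses are moved to
the marked points of level `l`; the induction hypothesis is applied there. -/
theorem IsRefiningScheme.wasserstein_map_le [StandardBorelSpace α] [Nonempty α]
    {T : ℕ → α → α} {S : ℕ → Finset α} {δ : ℕ → ℝ≥0∞} (h : IsRefiningScheme T S δ) (l : ℕ) :
    ∀ (μ ν : Measure α) [IsFiniteMeasure μ] [IsFiniteMeasure ν], μ Set.univ = ν Set.univ →
      wasserstein (μ.map (T l)) (ν.map (T l)) ≤ ∑ i ∈ Finset.range l, δ i *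
        ∑ y ∈ S (i + 1), absDiff (μ (T (i + 1) ⁻¹' {y})) (ν (T (i + 1) ⁻¹' {y})) := by
  induction l with
  | zero =>
    intro μ ν _ _ hμν
    have hconst : T 0 = fun _ => T 0 (Classical.arbitrary α) := by
      funext x
      exact h.zero _ _
    rw [hconst, Measure.map_const, Measure.map_const, hμν, wasserstein_self]
    exact zero_le
  | succ l ih =>
    intro μ ν _ _ hμν
    set p : α → ℝ≥0∞ := fun y => μ (T (l + 1) ⁻¹' {y})
    set q : α → ℝ≥0∞ := fun y => ν (T (l + 1) ⁻¹' {y})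
    set c : Measure α := ∑ y ∈ S (l + 1), min (p y) (q y) • Measure.dirac y
    set μ' : Measure α := ∑ y ∈ S (l + 1), (p y - q y) • Measure.dirac y with hμ'
    set ν' : Measure α := ∑ y ∈ S (l + 1), (q y - p y) • Measure.dirac y with hν'
    have hp : ∀ y, p y ≠ ∞ := fun y => measure_ne_top _ _
    have hq : ∀ y, q y ≠ ∞ := fun y => measure_ne_top _ _
    have hμc : μ.map (T (l + 1)) = c + μ' := by
      rw [map_eq_sum_smul_dirac μ _ (h.measurable _) (h.mem _), ← Finset.sum_add_distrib]
      refine Finset.sum_congr rfl fun y _ => ?_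
      rw [← add_smul]
      congr 1
      rcases le_total (p y) (q y) with hpq | hpq
      · rw [min_eq_left hpq, tsub_eq_zero_of_le hpq, add_zero]
      · rw [min_eq_right hpq, add_tsub_cancel_of_le hpq]
    have hνc : ν.map (T (l + 1)) = c + ν' := by
      rw [map_eq_sum_smul_dirac ν _ (h.measurable _) (h.mem _), ← Finset.sum_add_distrib]
      refine Finset.sum_congr rfl fun y _ => ?_
      rw [← add_smul]
      congr 1
      rcases le_total (p y) (q y) with hpq | hpq
      · rw [min_eq_left hpq, add_tsub_cancel_of_le hpq]
      · rw [min_eq_right hpq, tsub_eq_zero_of_le hpq, add_zero]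
    have hmapμ : IsFiniteMeasure (c + μ') := hμc ▸ inferInstance
    have hmapν : IsFiniteMeasure (c + ν') := hνc ▸ inferInstance
    have hcfin : IsFiniteMeasure c := isFiniteMeasure_of_le (c + μ') (Measure.le_add_right le_rfl)
    have hμfin : IsFiniteMeasure μ' := isFiniteMeasure_of_le (c + μ') (Measure.le_add_left le_rfl)
    have hνfin : IsFiniteMeasure ν' := isFiniteMeasure_of_le (c + ν') (Measure.le_add_left le_rfl)
    have hmass : μ' Set.univ = ν' Set.univ := by
      have e : (c + μ') Set.univ = (c + ν') Set.univ := by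
        rw [← hμc, ← hνc, Measure.map_apply (h.measurable _) .univ,
          Measure.map_apply (h.measurable _) .univ, Set.preimage_univ, hμν]
      rw [Measure.add_apply, Measure.add_apply] at e
      exact (ENNReal.add_right_inj (measure_ne_top c _)).1 e
    -- removing the common part does not change differences of masses of coarser cells
    have hdiff : ∀ i < l, ∀ y, absDiff (μ' (T (i + 1) ⁻¹' {y})) (ν' (T (i + 1) ⁻¹' {y}))
        = absDiff (μ (T (i + 1) ⁻¹' {y})) (ν (T (i + 1) ⁻¹' {y})) := by
      intro i hi y
      have hset : MeasurableSet (T (i + 1) ⁻¹' {y}) := h.measurable _ (measurableSet_singleton y)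
      have hpre : T (l + 1) ⁻¹' (T (i + 1) ⁻¹' {y}) = T (i + 1) ⁻¹' {y} := by
        ext x
        simp only [Set.mem_preimage, h.comp_of_le (show i + 1 < l + 1 by omega)]
      have e₁ : μ (T (i + 1) ⁻¹' {y}) = c (T (i + 1) ⁻¹' {y}) + μ' (T (i + 1) ⁻¹' {y}) := by
        rw [← Measure.add_apply, ← hμc, Measure.map_apply (h.measurable _) hset, hpre]
      have e₂ : ν (T (i + 1) ⁻¹' {y}) = c (T (i + 1) ⁻¹' {y}) + ν' (T (i + 1) ⁻¹' {y}) := by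
        rw [← Measure.add_apply, ← hνc, Measure.map_apply (h.measurable _) hset, hpre]
      rw [e₁, e₂, absDiff_add_left (measure_ne_top c _)]
    have hexc : μ' Set.univ + ν' Set.univ = ∑ y ∈ S (l + 1), absDiff (p y) (q y) := by
      rw [hμ', hν', Measure.finsetSum_apply, Measure.finsetSum_apply, ← Finset.sum_add_distrib]
      simp [absDiff]
    rw [hμc, hνc, Finset.sum_range_succ]
    calc wasserstein (c + μ') (c + ν') ≤ wasserstein c c + wasserstein μ' ν' :=
          wasserstein_add_le _ _ _ _
      _ = wasserstein μ' ν' := by rw [wasserstein_self, zero_add]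
      _ ≤ wasserstein μ' (μ'.map (T l)) + wasserstein (μ'.map (T l)) ν' :=
          wasserstein_triangle _ _ _
      _ ≤ wasserstein μ' (μ'.map (T l)) +
            (wasserstein (μ'.map (T l)) (ν'.map (T l)) + wasserstein (ν'.map (T l)) ν') := by
          gcongr
          exact wasserstein_triangle _ _ _
      _ ≤ δ l * μ' Set.univ + (∑ i ∈ Finset.range l, δ i *
            ∑ y ∈ S (i + 1), absDiff (μ (T (i + 1) ⁻¹' {y})) (ν (T (i + 1) ⁻¹' {y}))
            + δ l * ν' Set.univ) := by
          gcongr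
          · exact wasserstein_self_map_le _ (h.measurable l) (h.edist_le l)
          · refine (ih μ' ν' hmass).trans_eq (Finset.sum_congr rfl fun i hi => ?_)
            rw [Finset.sum_congr rfl fun y _ => hdiff i (Finset.mem_range.1 hi) y]
          · rw [wasserstein_comm]
            exact wasserstein_self_map_le _ (h.measurable l) (h.edist_le l)
      _ = _ := by
          rw [← hexc]
          ring

theorem IsRefiningScheme.wasserstein_le [StandardBorelSpace α] [Nonempty α]
    {T : ℕ → α → α} {S : ℕ → Finset α} {δ : ℕ → ℝ≥0∞} (h : IsRefiningScheme T S δ) (l : ℕ)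
    (μ ν : Measure α) [IsFiniteMeasure μ] [IsFiniteMeasure ν] (hμν : μ Set.univ = ν Set.univ) :
    wasserstein μ ν ≤ 2 * δ l * μ Set.univ + ∑ i ∈ Finset.range l, δ i *
        ∑ y ∈ S (i + 1), absDiff (μ (T (i + 1) ⁻¹' {y})) (ν (T (i + 1) ⁻¹' {y})) := by
  have h₁ := wasserstein_self_map_le μ (h.measurable l) (h.edist_le l)
  have h₂ := wasserstein_self_map_le ν (h.measurable l) (h.edist_le l)
  rw [wasserstein_comm, ← hμν] at h₂
  calc wasserstein μ ν
      ≤ wasserstein μ (μ.map (T l)) + wasserstein (μ.map (T l)) ν := wasserstein_triangle _ _ _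
    _ ≤ wasserstein μ (μ.map (T l)) +
          (wasserstein (μ.map (T l)) (ν.map (T l)) + wasserstein (ν.map (T l)) ν) := by
        gcongr
        exact wasserstein_triangle _ _ _
    _ ≤ δ l * μ Set.univ + (∑ i ∈ Finset.range l, δ i *
          ∑ y ∈ S (i + 1), absDiff (μ (T (i + 1) ⁻¹' {y})) (ν (T (i + 1) ⁻¹' {y}))
          + δ l * μ Set.univ) := by
        gcongr
        exact h.wasserstein_map_le l μ ν hμν
    _ = _ := by ring

end Multiscale

/-! ### Dyadic cubes -/

theorem edist_unitCube_le {d : ℕ} {ε : ℝ} (hε : 0 ≤ ε) (x y : unitCube d)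
    (h : ∀ i, |(x : EuclideanSpace ℝ (Fin d)) i - (y : EuclideanSpace ℝ (Fin d)) i| ≤ ε) :
    edist x y ≤ ENNReal.ofReal (√d * ε) := by
  rw [edist_dist, Subtype.dist_eq, EuclideanSpace.dist_eq]
  refine ENNReal.ofReal_le_ofReal (Real.sqrt_le_iff.2 ⟨by positivity, ?_⟩)
  calc ∑ i, dist ((x : EuclideanSpace ℝ (Fin d)) i) ((y : EuclideanSpace ℝ (Fin d)) i) ^ 2
      ≤ ∑ _i : Fin d, ε ^ 2 := Finset.sum_le_sum fun i _ => by
        rw [Real.dist_eq]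
        exact pow_le_pow_left₀ (abs_nonneg _) (h i) 2
    _ = (√d * ε) ^ 2 := by
        rw [mul_pow, Real.sq_sqrt (Nat.cast_nonneg d)]
        simp

theorem edist_unitCube_le_sqrt {d : ℕ} (x y : unitCube d) : edist x y ≤ ENNReal.ofReal √d := by
  have := edist_unitCube_le zero_le_one x y fun i => by
    have hx := x.2 i
    have hy := y.2 i
    rw [abs_le]
    constructor <;> linarith [hx.1, hx.2, hy.1, hy.2]
  simpa using this

/-- The number of the dyadic interval of level `l` that contains `t ∈ [0,1]`. The intervals are
closed on the left, and the point `1` belongs to the last one. -/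
noncomputable def dyadicIndex (l : ℕ) (t : ℝ) : ℕ := min ⌊2 ^ l * t⌋₊ (2 ^ l - 1)

theorem dyadicIndex_lt (l : ℕ) (t : ℝ) : dyadicIndex l t < 2 ^ l :=
  (min_le_right _ _).trans_lt (Nat.sub_lt (by positivity) one_pos)

theorem measurable_dyadicIndex (l : ℕ) : Measurable (dyadicIndex l) := by
  unfold dyadicIndex
  fun_prop

theorem abs_dyadicIndex_div_sub_le (l : ℕ) {t : ℝ} (ht : t ∈ Set.Icc (0 : ℝ) 1) :
    |(dyadicIndex l t : ℝ) / 2 ^ l - t| ≤ (1 / 2) ^ l := by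
  have h2 : (0 : ℝ) < 2 ^ l := by positivity
  have h0 : 0 ≤ 2 ^ l * t := mul_nonneg h2.le ht.1
  have hle : (dyadicIndex l t : ℝ) ≤ 2 ^ l * t :=
    (Nat.cast_le.2 (min_le_left _ _)).trans (Nat.floor_le h0)
  have hge : 2 ^ l * t ≤ dyadicIndex l t + 1 := by
    rcases le_total ⌊2 ^ l * t⌋₊ (2 ^ l - 1) with h | h
    · rw [dyadicIndex, min_eq_left h]
      exact (Nat.lt_floor_add_one _).le
    · rw [dyadicIndex, min_eq_right h, Nat.cast_sub Nat.one_le_two_pow]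
      push_cast
      nlinarith [ht.2]
  have e : (dyadicIndex l t : ℝ) / 2 ^ l - t = (dyadicIndex l t - 2 ^ l * t) / 2 ^ l := by
    field_simp
  rw [e, abs_div, abs_of_pos h2, one_div, inv_pow, ← one_div, div_le_div_iff_of_pos_right h2,
    abs_le]
  constructor <;> linarith

theorem dyadicIndex_comp_succ (l : ℕ) (t : ℝ) :
    dyadicIndex l ((dyadicIndex (l + 1) t : ℝ) / 2 ^ (l + 1)) = dyadicIndex l t := by
  have e₁ : (2 : ℝ) ^ l * ((dyadicIndex (l + 1) t : ℝ) / 2 ^ (l + 1))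
      = (dyadicIndex (l + 1) t : ℝ) / (2 : ℕ) := by
    rw [pow_succ]
    push_cast
    field_simp
  have e₂ : (2 : ℝ) ^ l * t = 2 ^ (l + 1) * t / (2 : ℕ) := by
    rw [pow_succ]
    push_cast
    field_simp
  unfold dyadicIndex at e₁ ⊢
  rw [e₁, e₂, Nat.floor_div_natCast, Nat.floor_div_natCast, Nat.floor_natCast, pow_succ]
  omega

/-- The point with coordinates `j i / 2 ^ l`. -/
noncomputable def dyadicPoint {d : ℕ} (l : ℕ) (j : Fin d → Fin (2 ^ l)) : unitCube d :=
  ⟨WithLp.toLp 2 fun i => ((j i : ℕ) : ℝ) / 2 ^ l, fun i => by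
    have h : ((j i : ℕ) : ℝ) ≤ 2 ^ l := by exact_mod_cast (j i).2.le
    exact ⟨by positivity, div_le_one_of_le₀ h (by positivity)⟩⟩

/-- The map that sends a point to the lower corner of its dyadic cube of level `l`. -/
noncomputable def dyadicMap {d : ℕ} (l : ℕ) (x : unitCube d) : unitCube d :=
  dyadicPoint l fun i => ⟨dyadicIndex l ((x : EuclideanSpace ℝ (Fin d)) i), dyadicIndex_lt _ _⟩

open Classical in
/-- The lower corners of the dyadic cubes of level `l`. -/
noncomputable def dyadicPoints (d l : ℕ) : Finset (unitCube d) := Finset.univ.image (dyadicPoint l)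

theorem card_dyadicPoints_le (d l : ℕ) : (dyadicPoints d l).card ≤ 2 ^ (l * d) := by
  refine Finset.card_image_le.trans ?_
  simp [pow_mul]

theorem isRefiningScheme_dyadicMap (d : ℕ) :
    IsRefiningScheme (dyadicMap (d := d)) (dyadicPoints d)
      fun l => ENNReal.ofReal (√d * (1 / 2) ^ l) where
  measurable l := by
    refine Measurable.subtype_mk ?_
    refine (WithLp.measurable_toLp 2 _).comp (measurable_pi_lambda _ fun i => ?_)
    have h₁ : Measurable fun x : unitCube d => (x : EuclideanSpace ℝ (Fin d)) i := by fun_prop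
    have h₂ : Measurable fun n : ℕ => (n : ℝ) / 2 ^ l := measurable_from_top
    exact h₂.comp ((measurable_dyadicIndex l).comp h₁)
  mem l x := Finset.mem_image_of_mem _ (Finset.mem_univ _)
  comp_succ l x := by
    have : ∀ i, dyadicIndex l (((dyadicMap (l + 1) x : unitCube d) :
        EuclideanSpace ℝ (Fin d)) i) = dyadicIndex l ((x : EuclideanSpace ℝ (Fin d)) i) :=
      fun i => dyadicIndex_comp_succ l _
    unfold dyadicMap at this ⊢
    simp only [this]
  zero x y := by
    have : Subsingleton (Fin (2 ^ 0)) := by rw [pow_zero]; infer_instance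
    exact congrArg (dyadicPoint 0) (Subsingleton.elim _ _)
  edist_le l x := edist_unitCube_le (by positivity) _ _ fun i =>
    abs_dyadicIndex_div_sub_le l (x.2 i)

theorem IsCenterMap.edist_le {d k : ℕ} {φ : unitCube d → unitCube d} (h : IsCenterMap k φ)
    (x : unitCube d) : edist (φ x) x ≤ ENNReal.ofReal (√d * (1 / k)) := by
  obtain ⟨j, hj⟩ := h.2 x
  refine edist_unitCube_le (by positivity) _ _ fun i => ?_
  obtain ⟨⟨h₁, h₂⟩, h₃⟩ := hj i
  have hk : (0 : ℝ) ≤ 1 / k := by positivity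
  rw [add_div] at h₂
  rw [h₃, add_div, abs_le, div_right_comm (1 : ℝ)]
  constructor <;> linarith

/-- The values of a centre map: there are at most `k ^ d` of them. -/
theorem IsCenterMap.exists_finset {d k : ℕ} {φ : unitCube d → unitCube d} (h : IsCenterMap k φ) :
    ∃ G : Finset (unitCube d), (∀ x, φ x ∈ G) ∧ G.card ≤ k ^ d := by
  classical
  choose j hj using h.2
  have hinj : ∀ x y, j x = j y → φ x = φ y := fun x y hxy => by
    ext i
    rw [(hj x i).2, (hj y i).2, hxy]
  refine ⟨Finset.univ.image fun a : Fin d → Fin k =>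
    if ha : ∃ x, j x = a then φ ha.choose else Classical.arbitrary _, fun x => ?_, ?_⟩
  · have hx : ∃ y, j y = j x := ⟨x, rfl⟩
    refine Finset.mem_image.2 ⟨j x, Finset.mem_univ _, ?_⟩
    rw [dif_pos hx]
    exact hinj _ _ hx.choose_spec
  · exact Finset.card_image_le.trans (by simp)

/-! ### Empirical means of independent samples -/

section Sample

variable {β : Type*}

/-- The empirical mean of `h` over the sample points `x 0, …, x (N - 1)`. -/
noncomputable def sampleMean (h : β → ℝ) (N : ℕ) (x : ℕ → β) : ℝ :=
  (N : ℝ)⁻¹ * ∑ n ∈ Finset.range N, h (x n)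

theorem abs_sampleMean_le {h : β → ℝ} {B : ℝ} (hB : ∀ z, |h z| ≤ B) {N : ℕ} (hN : 1 ≤ N)
    (x : ℕ → β) : |sampleMean h N x| ≤ B := by
  have hN' : (0 : ℝ) < N := by exact_mod_cast hN
  rw [sampleMean, abs_mul, abs_of_pos (inv_pos.2 hN'), inv_mul_le_iff₀ hN']
  refine (Finset.abs_sum_le_sum_abs _ _).trans ((Finset.sum_le_sum fun n _ => hB _).trans_eq ?_)
  simp

variable {Ω : Type*} [MeasurableSpace Ω] [MeasurableSpace β] {P : Measure Ω} {π : Measure β}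
  {X : ℕ → Ω → β}

theorem measurable_sampleMean (hX : IsIIDSample P π X) {h : β → ℝ} (hm : Measurable h) (N : ℕ) :
    Measurable fun ω => sampleMean h N fun n => X n ω := by
  unfold sampleMean
  have := hX.1
  fun_prop

variable [IsProbabilityMeasure P]

theorem integrable_abs_sampleMean (hX : IsIIDSample P π X) {h : β → ℝ} (hm : Measurable h) {B : ℝ}
    (hB : ∀ z, |h z| ≤ B) {N : ℕ} (hN : 1 ≤ N) :
    Integrable (fun ω => |sampleMean h N fun n => X n ω|) P := by
  refine Integrable.of_bound (measurable_sampleMean hX hm N).abs.aestronglyMeasurable B ?_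
  exact .of_forall fun ω => by
    rw [Real.norm_eq_abs, abs_abs]
    exact abs_sampleMean_le hB hN _

/-- By independence, the second moment of the empirical mean of a centred function is its second
moment under `π` divided by `N`. -/
theorem integral_abs_sampleMean_le (hX : IsIIDSample P π X) {h : β → ℝ} (hm : Measurable h) {B : ℝ}
    (hB : ∀ z, |h z| ≤ B) (h0 : ∫ z, h z ∂π = 0) {v : ℝ} (hv : ∫ z, h z ^ 2 ∂π ≤ v)
    {N : ℕ} (hN : 1 ≤ N) :
    ∫ ω, |sampleMean h N fun n => X n ω| ∂P ≤ √(v / N) := by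
  have hN' : (0 : ℝ) < N := by exact_mod_cast hN
  have hLp : ∀ n, MemLp (fun ω => h (X n ω)) 2 P := fun n =>
    MemLp.of_bound (hm.comp (hX.1 n)).aestronglyMeasurable B (.of_forall fun ω => hB _)
  have hmean : ∀ n, ∫ ω, h (X n ω) ∂P = 0 := fun n => by
    rw [← h0, ← hX.2.2 n, integral_map (hX.1 n).aemeasurable hm.aestronglyMeasurable]
  have hsq : ∀ n, ∫ ω, h (X n ω) ^ 2 ∂P = ∫ z, h z ^ 2 ∂π := fun n => by
    rw [← hX.2.2 n, integral_map (hX.1 n).aemeasurable (hm.pow_const 2).aestronglyMeasurable]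
  have hvar : ∀ n, variance (fun ω => h (X n ω)) P ≤ v := fun n => by
    rw [variance_of_integral_eq_zero (X := fun ω => h (X n ω)) (hm.comp (hX.1 n)).aemeasurable
      (hmean n)]
    exact (hsq n).trans_le hv
  have hsum : variance (∑ n ∈ Finset.range N, fun ω => h (X n ω)) P ≤ N * v := by
    rw [IndepFun.variance_sum (fun n _ => hLp n)]
    · exact (Finset.sum_le_sum fun n _ => hvar n).trans_eq (by simp)
    · intro m _ n _ hmn
      exact (hX.2.1.indepFun hmn).comp hm hm
  set Y : Ω → ℝ := fun ω => sampleMean h N fun n => X n ω with hY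
  have hYm : Measurable Y := measurable_sampleMean hX hm N
  have hYsq : ∫ ω, Y ω ^ 2 ∂P ≤ v / N := by
    have hY' : Y = fun ω => (N : ℝ)⁻¹ * (∑ n ∈ Finset.range N, fun ω => h (X n ω)) ω := by
      funext ω
      simp [hY, sampleMean]
    have hY0 : ∫ ω, Y ω ∂P = 0 := by
      simp only [hY, sampleMean]
      rw [integral_const_mul, integral_finsetSum _ fun n _ => (hLp n).integrable one_le_two]
      simp [hmean]
    rw [← variance_of_integral_eq_zero hYm.aemeasurable hY0, hY', variance_const_mul]
    calc ((N : ℝ)⁻¹) ^ 2 * _ ≤ ((N : ℝ)⁻¹) ^ 2 * (N * v) := by gcongr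
      _ = v / N := by field_simp
  have hYL : MemLp (fun ω => |Y ω|) 2 P :=
    MemLp.of_bound hYm.abs.aestronglyMeasurable B (.of_forall fun ω => by
      rw [Real.norm_eq_abs, abs_abs]
      exact abs_sampleMean_le hB hN _)
  refine Real.le_sqrt_of_sq_le (le_trans ?_ hYsq)
  have := variance_nonneg (fun ω => |Y ω|) P
  rw [variance_eq_sub hYL] at this
  simpa using this

/-- The expected total fluctuation of the empirical means of finitely many centred functions whose
second moments add up to at most `V`. -/
theorem sum_integral_abs_sampleMean_le (hX : IsIIDSample P π X) {ι : Type*} (I : Finset ι)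
    {h : ι → β → ℝ} (hm : ∀ i, Measurable (h i)) (hB : ∀ i z, |h i z| ≤ 1)
    (h0 : ∀ i, ∫ z, h i z ∂π = 0) {v : ι → ℝ} (hv : ∀ i, ∫ z, h i z ^ 2 ∂π ≤ v i)
    {V : ℝ} (hV : ∑ i ∈ I, v i ≤ V) {N : ℕ} (hN : 1 ≤ N) :
    ∑ i ∈ I, ∫ ω, |sampleMean (h i) N fun n => X n ω| ∂P ≤ √(V * I.card / N) := by
  have hN' : (0 : ℝ) < N := by exact_mod_cast hN
  have hv0 : ∀ i, 0 ≤ v i := fun i => (integral_nonneg fun z => sq_nonneg _).trans (hv i)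
  calc ∑ i ∈ I, ∫ ω, |sampleMean (h i) N fun n => X n ω| ∂P
      ≤ ∑ i ∈ I, √(v i / N) := Finset.sum_le_sum fun i _ =>
        integral_abs_sampleMean_le hX (hm i) (hB i) (h0 i) (hv i) hN
    _ ≤ √(V * I.card / N) := by
        refine Real.le_sqrt_of_sq_le ((sq_sum_le_card_mul_sum_sq).trans ?_)
        have : ∑ i ∈ I, √(v i / N) ^ 2 = (∑ i ∈ I, v i) / N := by
          rw [Finset.sum_div]
          exact Finset.sum_congr rfl fun i _ => Real.sq_sqrt (div_nonneg (hv0 i) hN'.le)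
        rw [this, mul_comm V, mul_div_assoc]
        gcongr

end Sample

/-! ### The rate -/

theorem rate_pos {d N : ℕ} (hN : 1 ≤ N) : 0 < rate d N := by
  have hN' : (0 : ℝ) < N := by exact_mod_cast hN
  have : 0 < Real.log ((N : ℝ) + 1) := Real.log_pos (by linarith)
  unfold rate
  split_ifs <;> positivity

/-- The resolution `N ^ (-r)` of the grid is at most of the order of the rate. -/
theorem rpow_neg_gridExponent_le {d N : ℕ} (hN : 1 ≤ N) :
    (N : ℝ) ^ (-gridExponent d) ≤ 2 * rate d N := by
  have hN' : (0 : ℝ) < N := by exact_mod_cast hN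
  have hN1 : (1 : ℝ) ≤ N := by exact_mod_cast hN
  have hlog : (1 : ℝ) ≤ 2 * Real.log ((N : ℝ) + 1) := by
    have : Real.log 2 ≤ Real.log ((N : ℝ) + 1) := Real.log_le_log two_pos (by linarith)
    linarith [Real.log_two_gt_d9]
  unfold gridExponent rate
  split_ifs with h1 h2
  · have := Real.rpow_pos_of_pos hN' (-(1 / 3))
    linarith
  · subst h2
    have := Real.rpow_pos_of_pos hN' (-(1 / 4))
    norm_num at this ⊢
    nlinarith
  · have := Real.rpow_pos_of_pos hN' (-(1 / (2 * (d : ℝ))))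
    linarith

theorem gridExponent_pos {d : ℕ} (hd : 1 ≤ d) : 0 < gridExponent d := by
  have : (0 : ℝ) < d := by exact_mod_cast hd
  unfold gridExponent
  split_ifs <;> positivity

theorem gridExponent_le {d : ℕ} (hd : 1 ≤ d) : gridExponent d ≤ 1 / 2 := by
  unfold gridExponent
  split_ifs
  · norm_num
  · have : (1 : ℝ) ≤ d := by exact_mod_cast hd
    exact one_div_le_one_div_of_le two_pos (by linarith)

theorem inv_sqrt_le_rate {d N : ℕ} (hd : 1 ≤ d) (hN : 1 ≤ N) : √(1 / N) ≤ 2 * rate d N := by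
  have hN1 : (1 : ℝ) ≤ N := by exact_mod_cast hN
  refine le_trans ?_ (rpow_neg_gridExponent_le hN)
  rw [Real.sqrt_eq_rpow, one_div, Real.inv_rpow (by positivity), ← Real.rpow_neg (by positivity)]
  exact Real.rpow_le_rpow_of_exponent_le hN1 (neg_le_neg (gridExponent_le hd))

theorem one_div_le_rate {d N k : ℕ} (hN : 1 ≤ N) (hk : 0 < k)
    (h : |(k : ℝ) - (N : ℝ) ^ gridExponent d| < 1) : (1 : ℝ) / k ≤ 4 * rate d N := by
  have hN' : (0 : ℝ) < N := by exact_mod_cast hN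
  have hk' : (1 : ℝ) ≤ k := by exact_mod_cast hk
  have h₁ : (N : ℝ) ^ gridExponent d ≤ 2 * k := by linarith [(abs_lt.1 h).1]
  have h₂ := rpow_neg_gridExponent_le (d := d) hN
  rw [Real.rpow_neg hN'.le] at h₂
  have h₃ : 0 < (N : ℝ) ^ gridExponent d := by positivity
  have : (2 * (k : ℝ))⁻¹ ≤ ((N : ℝ) ^ gridExponent d)⁻¹ := by gcongr
  rw [mul_inv] at this
  rw [one_div]
  linarith

theorem cast_le_two_mul_rpow {d N k : ℕ} (hd : 1 ≤ d) (hN : 1 ≤ N)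
    (h : |(k : ℝ) - (N : ℝ) ^ gridExponent d| < 1) : (k : ℝ) ≤ 2 * (N : ℝ) ^ gridExponent d := by
  have hN1 : (1 : ℝ) ≤ N := by exact_mod_cast hN
  have := Real.one_le_rpow hN1 (gridExponent_pos hd).le
  linarith [(abs_lt.1 h).2]

theorem two_pow_clog_le {k : ℕ} (hk : 0 < k) : 2 ^ Nat.clog 2 k ≤ 2 * k := by
  rcases Nat.eq_or_lt_of_le (Nat.succ_le_of_lt hk) with h | h
  · simp [← h]
  · have hpos := Nat.clog_pos one_lt_two h
    have := Nat.pow_pred_clog_lt_self one_lt_two h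
    obtain ⟨m, hm⟩ := Nat.exists_eq_succ_of_ne_zero hpos.ne'
    rw [hm] at this ⊢
    simp only [Nat.succ_eq_add_one, Nat.pred_succ] at this
    rw [pow_succ]
    omega

theorem sqrt_pow_eq {a : ℝ} (ha : 0 ≤ a) (n : ℕ) : √(a ^ n) = √a ^ n := by
  rw [Real.sqrt_eq_iff_eq_sq (by positivity) (by positivity), ← pow_mul, mul_comm, pow_mul,
    Real.sq_sqrt ha]

/-- The terms of the sum over the dyadic scales form a geometric progression. -/
theorem sum_scales_eq (d N k J : ℕ) :
    ∑ i ∈ Finset.range J, (1 / 2 : ℝ) ^ i * √((k ^ d * 2 ^ ((i + 1) * d) : ℝ) / N)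
      = √((2 * k : ℝ) ^ d / N) * ∑ i ∈ Finset.range J, (√(2 ^ d) / 2) ^ i := by
  rw [Finset.mul_sum]
  refine Finset.sum_congr rfl fun i _ => ?_
  have e : ((k : ℝ) ^ d * 2 ^ ((i + 1) * d)) / N = (2 * k : ℝ) ^ d / N * (2 ^ d) ^ i := by
    rw [mul_pow, add_mul, one_mul, pow_add, mul_comm i d, pow_mul]
    ring
  rw [e, Real.sqrt_mul (by positivity), div_pow, sqrt_pow_eq (by positivity), div_pow, one_pow]
  ring

theorem sum_scales_le_one {N k : ℕ} (hN : 1 ≤ N)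
    (h : |(k : ℝ) - (N : ℝ) ^ gridExponent 1| < 1) (J : ℕ) :
    √((2 * k : ℝ) ^ 1 / N) * ∑ i ∈ Finset.range J, (√(2 ^ 1) / 2) ^ i ≤ 8 * rate 1 N := by
  have hN' : (0 : ℝ) < N := by exact_mod_cast hN
  have hk := cast_le_two_mul_rpow le_rfl hN h
  have hs2 : √2 ≤ 3 / 2 := Real.sqrt_le_iff.2 ⟨by norm_num, by norm_num⟩
  have h₁ : ∑ i ∈ Finset.range J, (√(2 ^ 1) / 2) ^ i ≤ 4 := by
    have h0 : 0 < (√2 / 2) ^ J := by positivity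
    rw [pow_one, geom_sum_eq (by linarith), div_le_iff_of_neg (by linarith)]
    linarith
  have h₂ : √((2 * k : ℝ) ^ 1 / N) ≤ 2 * rate 1 N := by
    refine Real.sqrt_le_iff.2 ⟨by have := rate_pos (d := 1) hN; positivity, ?_⟩
    have e : rate 1 N ^ 2 = (N : ℝ) ^ gridExponent 1 / N := by
      rw [rate, if_pos rfl, gridExponent, if_pos rfl, ← Real.rpow_natCast, ← Real.rpow_mul hN'.le,
        ← Real.rpow_sub_one hN'.ne']
      norm_num
    rw [mul_pow 2 (rate 1 N), e, pow_one, mul_div_assoc']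
    exact div_le_div_of_nonneg_right (by linarith) hN'.le
  calc _ ≤ 2 * rate 1 N * 4 := by
        have := rate_pos (d := 1) hN
        gcongr
    _ = _ := by ring

theorem clog_le_log {N k : ℕ} (hN : 1 ≤ N) (hk : 0 < k)
    (h : |(k : ℝ) - (N : ℝ) ^ gridExponent 2| < 1) :
    (Nat.clog 2 k : ℝ) ≤ 5 * Real.log ((N : ℝ) + 1) := by
  have hN1 : (1 : ℝ) ≤ N := by exact_mod_cast hN
  have hk' := cast_le_two_mul_rpow one_le_two hN h
  have h₁ : ((2 : ℝ) ^ Nat.clog 2 k) ≤ 4 * (N + 1) := by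
    have a : ((2 : ℝ) ^ Nat.clog 2 k) ≤ 2 * k := by exact_mod_cast two_pow_clog_le hk
    have b : (N : ℝ) ^ gridExponent 2 ≤ (N : ℝ) ^ (1 : ℝ) :=
      Real.rpow_le_rpow_of_exponent_le hN1 ((gridExponent_le one_le_two).trans (by norm_num))
    rw [Real.rpow_one] at b
    linarith
  have h₂ := Real.log_le_log (by positivity) h₁
  have h4 : Real.log 4 = 2 * Real.log 2 := by
    rw [show (4 : ℝ) = 2 ^ 2 by norm_num, Real.log_pow]
    norm_num
  rw [Real.log_pow, Real.log_mul (by norm_num) (by positivity), h4] at h₂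
  have h₃ : Real.log 2 ≤ Real.log ((N : ℝ) + 1) := Real.log_le_log two_pos (by linarith)
  have h₅ := Real.log_two_gt_d9
  have h₆ : (0 : ℝ) ≤ Nat.clog 2 k := Nat.cast_nonneg _
  nlinarith

theorem sum_scales_le_two {N k : ℕ} (hN : 1 ≤ N) (hk : 0 < k)
    (h : |(k : ℝ) - (N : ℝ) ^ gridExponent 2| < 1) :
    √((2 * k : ℝ) ^ 2 / N) * ∑ i ∈ Finset.range (Nat.clog 2 k), (√(2 ^ 2) / 2) ^ i
      ≤ 20 * rate 2 N := by
  have hN' : (0 : ℝ) < N := by exact_mod_cast hN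
  have hk' := cast_le_two_mul_rpow one_le_two hN h
  have hJ := clog_le_log hN hk h
  have e : √((2 : ℝ) ^ 2) / 2 = 1 := by rw [Real.sqrt_sq two_pos.le, div_self two_ne_zero]
  have h₁ : √((2 * k : ℝ) ^ 2 / N) ≤ 4 * (N : ℝ) ^ (-(1 / 4) : ℝ) := by
    rw [Real.sqrt_div (by positivity), Real.sqrt_sq (by positivity), div_le_iff₀ (by positivity),
      Real.sqrt_eq_rpow, mul_assoc, ← Real.rpow_add hN']
    norm_num [gridExponent] at hk' ⊢
    linarith
  simp only [e, one_pow, Finset.sum_const, Finset.card_range, nsmul_eq_mul, mul_one]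
  calc _ ≤ 4 * (N : ℝ) ^ (-(1 / 4) : ℝ) * (5 * Real.log ((N : ℝ) + 1)) := by gcongr
    _ = _ := by simp only [rate]; norm_num; ring

theorem sum_scales_le_of_three_le {d N k : ℕ} (hd : 3 ≤ d) (hN : 1 ≤ N) (hk : 0 < k)
    (h : |(k : ℝ) - (N : ℝ) ^ gridExponent d| < 1) :
    √((2 * k : ℝ) ^ d / N) * ∑ i ∈ Finset.range (Nat.clog 2 k), (√(2 ^ d) / 2) ^ i
      ≤ 4 * 4 ^ d * rate d N := by
  have hN' : (0 : ℝ) < N := by exact_mod_cast hN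
  have hk0 : (0 : ℝ) < k := by exact_mod_cast hk
  have hk' := cast_le_two_mul_rpow (by omega) hN h
  set J := Nat.clog 2 k
  set ρ : ℝ := √(2 ^ d) / 2 with hρ
  have hρ2 : 5 / 4 ≤ ρ := by
    rw [hρ, le_div_iff₀ two_pos]
    refine Real.le_sqrt_of_sq_le ?_
    calc (5 / 4 * 2 : ℝ) ^ 2 ≤ 2 ^ 3 := by norm_num
      _ ≤ 2 ^ d := pow_le_pow_right₀ one_le_two hd
  have h₁ : ∑ i ∈ Finset.range J, ρ ^ i ≤ 4 * ρ ^ J := by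
    rw [geom_sum_eq (by linarith), div_le_iff₀ (by linarith)]
    have : 0 < ρ ^ J := by positivity
    nlinarith
  have h₂ : ρ ^ J ≤ √((2 * k : ℝ) ^ d) / k := by
    have a : ((2 : ℝ) ^ J) ≤ 2 * k := by exact_mod_cast two_pow_clog_le hk
    have b : (k : ℝ) ≤ 2 ^ J := by exact_mod_cast Nat.le_pow_clog one_lt_two k
    have c : √(2 ^ d) ^ J = √((2 ^ J : ℝ) ^ d) := by
      rw [← sqrt_pow_eq (by positivity), ← pow_mul, ← pow_mul, mul_comm]
    rw [hρ, div_pow, c]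
    gcongr
  have h₃ : √((2 * k : ℝ) ^ d / N) * (4 * (√((2 * k : ℝ) ^ d) / k))
      = 4 * (2 ^ d * k ^ (d - 1) / √N) := by
    rw [Real.sqrt_div (by positivity)]
    have : √((2 * k : ℝ) ^ d) * √((2 * k : ℝ) ^ d) = 2 ^ d * (k ^ (d - 1) * k) := by
      rw [Real.mul_self_sqrt (by positivity), mul_pow, ← pow_succ, Nat.sub_add_cancel (by omega)]
    field_simp
    linear_combination this
  have h₄ : (k : ℝ) ^ (d - 1) / √N ≤ 2 ^ d * rate d N := by
    have e : ((N : ℝ) ^ gridExponent d) ^ (d - 1) = rate d N * √N := by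
      have hd0 : (d : ℝ) ≠ 0 := by exact_mod_cast (by omega : d ≠ 0)
      rw [gridExponent, rate, if_neg (by omega), if_neg (by omega), if_neg (by omega),
        Real.sqrt_eq_rpow, ← Real.rpow_natCast, ← Real.rpow_mul hN'.le, ← Real.rpow_add hN',
        Nat.cast_sub (by omega)]
      congr 1
      field_simp
      push_cast
      ring
    rw [div_le_iff₀ (by positivity), mul_assoc, ← e]
    calc (k : ℝ) ^ (d - 1) ≤ (2 * (N : ℝ) ^ gridExponent d) ^ (d - 1) := by gcongr
      _ = 2 ^ (d - 1) * ((N : ℝ) ^ gridExponent d) ^ (d - 1) := mul_pow _ _ _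
      _ ≤ 2 ^ d * ((N : ℝ) ^ gridExponent d) ^ (d - 1) := by
        gcongr
        · norm_num
        · omega
  calc √((2 * k : ℝ) ^ d / N) * ∑ i ∈ Finset.range J, ρ ^ i
      ≤ √((2 * k : ℝ) ^ d / N) * (4 * (√((2 * k : ℝ) ^ d) / k)) := by
        gcongr
        exact h₁.trans (by gcongr)
    _ = 4 * (2 ^ d * ((k : ℝ) ^ (d - 1) / √N)) := by rw [h₃, mul_div_assoc]
    _ ≤ 4 * (2 ^ d * (2 ^ d * rate d N)) := by gcongr
    _ = 4 * 4 ^ d * rate d N := by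
        rw [show (4 : ℝ) ^ d = 2 ^ d * 2 ^ d by rw [← mul_pow]; norm_num]
        ring

theorem sum_scales_le {d N k : ℕ} (hd : 1 ≤ d) (hN : 1 ≤ N) (hk : 0 < k)
    (h : |(k : ℝ) - (N : ℝ) ^ gridExponent d| < 1) :
    ∑ i ∈ Finset.range (Nat.clog 2 k), (1 / 2 : ℝ) ^ i * √((k ^ d * 2 ^ ((i + 1) * d) : ℝ) / N)
      ≤ 5 * 4 ^ d * rate d N := by
  have hr := rate_pos (d := d) hN
  rw [sum_scales_eq]
  rcases (by omega : d = 1 ∨ d = 2 ∨ 3 ≤ d) with rfl | rfl | hd3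
  · refine (sum_scales_le_one hN h _).trans ?_
    gcongr
    norm_num
  · refine (sum_scales_le_two hN hk h).trans ?_
    gcongr
    norm_num
  · refine (sum_scales_le_of_three_le hd3 hN hk h).trans ?_
    gcongr
    norm_num

/-! ### Fluctuations of the empirical measure in the cells of a partition -/

section Fluctuation

variable {α : Type*} [MeasurableSpace α]

/-- The function `1_A(x₁) (1_Q(x₂) - η_{x₁}(Q))` of a pair `(x₁, x₂)`. -/
noncomputable def fluctuation (η : Kernel α α) (A Q : Set α) (z : α × α) : ℝ :=
  A.indicator (fun _ => Q.indicator (fun _ => (1 : ℝ)) z.2 - (η z.1).real Q) z.1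

theorem measurable_fluctuation (η : Kernel α α) {A Q : Set α} (hA : MeasurableSet A)
    (hQ : MeasurableSet Q) : Measurable (fluctuation η A Q) := by
  have h₁ : Measurable fun z : α × α => Q.indicator (fun _ => (1 : ℝ)) z.2 :=
    (measurable_const.indicator hQ).comp measurable_snd
  have h₂ : Measurable fun z : α × α => (η z.1).real Q :=
    ((η.measurable_coe hQ).comp measurable_fst).ennreal_toReal
  exact (h₁.sub h₂).indicator (measurable_fst hA)

theorem abs_fluctuation_le (η : Kernel α α) [IsMarkovKernel η] (A Q : Set α) (z : α × α) :
    |fluctuation η A Q z| ≤ 1 := by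
  have h₁ : (η z.1).real Q ≤ 1 := measureReal_le_one
  have h₀ : 0 ≤ (η z.1).real Q := measureReal_nonneg
  unfold fluctuation
  by_cases hA : z.1 ∈ A <;> by_cases hQ : z.2 ∈ Q <;> simp [hA, hQ, abs_le] <;>
    linarith

/-- The family `η` has, on average over `A`, the same mass in `Q` as the disintegration of `π`. -/
def MatchesOn (π : Measure (α × α)) (η : Kernel α α) (A Q : Set α) : Prop :=
  ∫⁻ x in A, η x Q ∂π.fst = π (A ×ˢ Q)

variable {π : Measure (α × α)} {η : Kernel α α} {A Q : Set α}

theorem fluctuation_eq_sub (z : α × α) : fluctuation η A Q z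
    = (A ×ˢ Q).indicator (fun _ => (1 : ℝ)) z - A.indicator (fun x => (η x).real Q) z.1 := by
  unfold fluctuation
  by_cases hA : z.1 ∈ A <;> by_cases hQ : z.2 ∈ Q <;> simp [hA, hQ, Set.indicator]

theorem integral_indicator_prod (hA : MeasurableSet A) (hQ : MeasurableSet Q) :
    ∫ z, (A ×ˢ Q).indicator (fun _ => (1 : ℝ)) z ∂π = π.real (A ×ˢ Q) := by
  rw [integral_indicator (hA.prod hQ)]
  simp

variable [IsMarkovKernel η]

theorem integral_indicator_kernel (hA : MeasurableSet A) (hQ : MeasurableSet Q)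
    (h : MatchesOn π η A Q) :
    ∫ z, A.indicator (fun x => (η x).real Q) z.1 ∂π = π.real (A ×ˢ Q) := by
  have hm : Measurable fun x => (η x).real Q := (η.measurable_coe hQ).ennreal_toReal
  have e : ∫ z, A.indicator (fun x => (η x).real Q) z.1 ∂π
      = ∫ x, A.indicator (fun x => (η x).real Q) x ∂π.fst := by
    rw [Measure.fst, integral_map measurable_fst.aemeasurable
      (hm.indicator hA).aestronglyMeasurable]
  rw [e, integral_indicator hA, measureReal_def, ← h]
  exact integral_toReal (η.measurable_coe hQ).aemeasurable
    (.of_forall fun x => measure_lt_top _ _)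

variable [IsProbabilityMeasure π]

theorem integrable_indicator_kernel (hA : MeasurableSet A) (hQ : MeasurableSet Q) :
    Integrable (fun z : α × α => A.indicator (fun x => (η x).real Q) z.1) π := by
  have hm : Measurable fun x => (η x).real Q := (η.measurable_coe hQ).ennreal_toReal
  refine Integrable.of_bound ((hm.indicator hA).comp measurable_fst).aestronglyMeasurable 1
    (.of_forall fun z => ?_)
  rw [Real.norm_eq_abs]
  by_cases hz : z.1 ∈ A
  · simp only [hz, Set.indicator_of_mem]
    rw [abs_of_nonneg measureReal_nonneg]
    exact measureReal_le_one
  · simp [hz]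

theorem integrable_indicator_prod (hA : MeasurableSet A) (hQ : MeasurableSet Q) :
    Integrable (fun z : α × α => (A ×ˢ Q).indicator (fun _ => (1 : ℝ)) z) π :=
  (integrable_const 1).indicator (hA.prod hQ)

theorem integral_fluctuation (hA : MeasurableSet A) (hQ : MeasurableSet Q)
    (h : MatchesOn π η A Q) : ∫ z, fluctuation η A Q z ∂π = 0 := by
  simp only [fluctuation_eq_sub]
  rw [integral_sub (integrable_indicator_prod hA hQ) (integrable_indicator_kernel hA hQ),
    integral_indicator_kernel hA hQ h, integral_indicator_prod hA hQ, sub_self]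

theorem integral_fluctuation_sq_le (hA : MeasurableSet A) (hQ : MeasurableSet Q)
    (h : MatchesOn π η A Q) :
    ∫ z, fluctuation η A Q z ^ 2 ∂π ≤ 2 * π.real (A ×ˢ Q) := by
  -- the square of a difference of numbers in `[0,1]` is at most their sum
  have hle : ∀ z, fluctuation η A Q z ^ 2 ≤ (A ×ˢ Q).indicator (fun _ => (1 : ℝ)) z
      + A.indicator (fun x => (η x).real Q) z.1 := fun z => by
    have h₁ : (η z.1).real Q ≤ 1 := measureReal_le_one
    have h₀ : 0 ≤ (η z.1).real Q := measureReal_nonneg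
    rw [fluctuation_eq_sub]
    by_cases hA : z.1 ∈ A <;> by_cases hQ : z.2 ∈ Q <;> simp [hA, hQ, Set.indicator] <;> nlinarith
  refine (integral_mono ?_ ((integrable_indicator_prod hA hQ).add
    (integrable_indicator_kernel hA hQ)) hle).trans_eq ?_
  · refine Integrable.of_bound
      ((measurable_fluctuation η hA hQ).pow_const 2).aestronglyMeasurable 1 (.of_forall fun z => ?_)
    rw [Real.norm_eq_abs, abs_pow]
    exact pow_le_one₀ (abs_nonneg _) (abs_fluctuation_le η A Q z)
  · rw [integral_add' (integrable_indicator_prod hA hQ) (integrable_indicator_kernel hA hQ),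
      integral_indicator_kernel hA hQ h, integral_indicator_prod hA hQ]
    ring

end Fluctuation

/-! ### Expected Wasserstein distance in the cells of a partition -/

section Cells

variable {α : Type*}

open Classical in
/-- The fraction of the sample points whose first coordinate is in the cell `ψ ⁻¹' {g}`. -/
noncomputable def cellMass (ψ : α → α) (N : ℕ) (x : ℕ → α × α) (g : α) : ℝ≥0∞ :=
  (N : ℝ≥0∞)⁻¹ * ((Finset.range N).filter fun n => ψ (x n).1 = g).card

theorem cellMass_ne_top (ψ : α → α) {N : ℕ} (hN : 1 ≤ N) (x : ℕ → α × α) (g : α) :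
    cellMass ψ N x g ≠ ∞ :=
  ENNReal.mul_ne_top (ENNReal.inv_ne_top.2 (by exact_mod_cast (by omega : N ≠ 0)))
    (ENNReal.natCast_ne_top _)

theorem sum_cellMass_mul (ψ : α → α) (N : ℕ) (x : ℕ → α × α) (f : α → ℝ≥0∞) {G : Finset α}
    (hG : ∀ y, ψ y ∈ G) :
    ∑ g ∈ G, cellMass ψ N x g * f g
      = (N : ℝ≥0∞)⁻¹ * ∑ n ∈ Finset.range N, f (ψ (x n).1) := by
  classical
  rw [← Finset.sum_fiberwise_of_maps_to (t := G) (g := fun n => ψ (x n).1) (fun n _ => hG _),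
    Finset.mul_sum]
  refine Finset.sum_congr rfl fun g _ => ?_
  rw [Finset.sum_congr rfl fun n hn => by rw [(Finset.mem_filter.1 hn).2], Finset.sum_const,
    nsmul_eq_mul, cellMass, mul_assoc]

theorem sum_cellMass (ψ : α → α) {N : ℕ} (hN : 1 ≤ N) (x : ℕ → α × α) {G : Finset α}
    (hG : ∀ y, ψ y ∈ G) : ∑ g ∈ G, cellMass ψ N x g = 1 := by
  have h := sum_cellMass_mul ψ N x (fun _ => 1) hG
  simp only [mul_one, Finset.sum_const, Finset.card_range, nsmul_eq_mul] at h
  rw [h]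
  exact ENNReal.inv_mul_cancel (by exact_mod_cast (by omega : N ≠ 0)) (ENNReal.natCast_ne_top _)

variable [MeasurableSpace α]

open Classical in
/-- The sum of the measures `μ n`, divided by `N`, over those `n < N` for which the first
coordinate of the sample point `x n` is in the cell `ψ ⁻¹' {g}`. -/
noncomputable def cellMean (ψ : α → α) (N : ℕ) (x : ℕ → α × α) (g : α) (μ : ℕ → Measure α) :
    Measure α :=
  (N : ℝ≥0∞)⁻¹ • ∑ n ∈ Finset.range N with ψ (x n).1 = g, μ n

theorem cellMean_univ (ψ : α → α) (N : ℕ) (x : ℕ → α × α) (g : α) (μ : ℕ → Measure α)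
    [∀ n, IsProbabilityMeasure (μ n)] : cellMean ψ N x g μ Set.univ = cellMass ψ N x g := by
  simp [cellMean, cellMass]

theorem cellMean_const (ψ : α → α) (N : ℕ) (x : ℕ → α × α) (g : α) (μ : Measure α) :
    cellMean ψ N x g (fun _ => μ) = cellMass ψ N x g • μ := by
  rw [cellMean, cellMass, Finset.sum_const, mul_smul, Nat.cast_smul_eq_nsmul]

/-- In terms of real numbers, the mass of a set under the mean over a cell. -/
theorem cellMean_apply (ψ : α → α) {N : ℕ} (hN : 1 ≤ N) (x : ℕ → α × α) (g : α)
    (μ : ℕ → Measure α) [∀ n, IsProbabilityMeasure (μ n)] (Q : Set α) :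
    cellMean ψ N x g μ Q = ENNReal.ofReal ((N : ℝ)⁻¹ * ∑ n ∈ Finset.range N,
      (ψ ⁻¹' {g}).indicator (fun _ => (μ n).real Q) (x n).1) := by
  classical
  have hN' : (0 : ℝ) < N := by exact_mod_cast hN
  rw [cellMean, Measure.smul_apply, Measure.finsetSum_apply, smul_eq_mul,
    ENNReal.ofReal_mul (by positivity), ENNReal.ofReal_inv_of_pos hN', ENNReal.ofReal_natCast,
    ENNReal.ofReal_sum_of_nonneg, Finset.sum_filter]
  swap
  · exact fun n _ => Set.indicator_nonneg (fun _ _ => measureReal_nonneg) _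
  congr 1
  refine Finset.sum_congr rfl fun n _ => ?_
  by_cases h : ψ (x n).1 = g <;> simp [h]

theorem absDiff_cellMean (ψ : α → α) {N : ℕ} (hN : 1 ≤ N) (x : ℕ → α × α) (g : α)
    (η : Kernel α α) [IsMarkovKernel η] {Q : Set α} (hQ : MeasurableSet Q) :
    absDiff (cellMean ψ N x g (fun n => Measure.dirac (x n).2) Q)
        (cellMean ψ N x g (fun n => η (x n).1) Q)
      = ENNReal.ofReal |sampleMean (fluctuation η (ψ ⁻¹' {g}) Q) N x| := by
  have hN' : (0 : ℝ) < N := by exact_mod_cast hN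
  rw [cellMean_apply ψ hN, cellMean_apply ψ hN, absDiff_ofReal, ← mul_sub,
    ← Finset.sum_sub_distrib, sampleMean]
  · congr 3
    refine Finset.sum_congr rfl fun n _ => ?_
    by_cases h : ψ (x n).1 = g <;> by_cases h' : (x n).2 ∈ Q <;>
      simp [h, h', fluctuation, measureReal_def, hQ]
  all_goals
    exact mul_nonneg (by positivity)
      (Finset.sum_nonneg fun n _ => Set.indicator_nonneg (fun _ _ => measureReal_nonneg) _)

end Cells

section CellBound

variable {d : ℕ}

/-- The multiscale bound for the sum over all cells `g ∈ G` of the distance between the sample in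
that cell and its conditional expectation, where the scales `1, …, 2 ^ (-J)` are used. -/
noncomputable def cellBound (η : Kernel (unitCube d) (unitCube d)) (ψ : unitCube d → unitCube d)
    (G : Finset (unitCube d)) (J N : ℕ) (x : ℕ → unitCube d × unitCube d) : ℝ :=
  2 * (√d * (1 / 2) ^ J) + ∑ i ∈ Finset.range J, √d * (1 / 2) ^ i *
    ∑ p ∈ G ×ˢ dyadicPoints d (i + 1),
      |sampleMean (fluctuation η (ψ ⁻¹' {p.1}) (dyadicMap (i + 1) ⁻¹' {p.2})) N x|

theorem cellBound_nonneg (η : Kernel (unitCube d) (unitCube d)) (ψ : unitCube d → unitCube d)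
    (G : Finset (unitCube d)) (J N : ℕ) (x : ℕ → unitCube d × unitCube d) :
    0 ≤ cellBound η ψ G J N x := by
  unfold cellBound
  positivity

theorem sum_wasserstein_cellMean_le (η : Kernel (unitCube d) (unitCube d)) [IsMarkovKernel η]
    {ψ : unitCube d → unitCube d} {G : Finset (unitCube d)} (hG : ∀ y, ψ y ∈ G) (J : ℕ) {N : ℕ}
    (hN : 1 ≤ N) (x : ℕ → unitCube d × unitCube d) :
    ∑ g ∈ G, wasserstein (cellMean ψ N x g fun n => Measure.dirac (x n).2)
        (cellMean ψ N x g fun n => η (x n).1)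
      ≤ ENNReal.ofReal (cellBound η ψ G J N x) := by
  have hT := isRefiningScheme_dyadicMap d
  have hfin : ∀ g (μ : ℕ → Measure (unitCube d)) [∀ n, IsProbabilityMeasure (μ n)],
      IsFiniteMeasure (cellMean ψ N x g μ) := fun g μ _ => ⟨by
    rw [cellMean_univ]
    exact (cellMass_ne_top ψ hN x g).lt_top⟩
  calc _ ≤ ∑ g ∈ G, (2 * ENNReal.ofReal (√d * (1 / 2) ^ J) * cellMass ψ N x g
        + ∑ i ∈ Finset.range J, ENNReal.ofReal (√d * (1 / 2) ^ i) *
          ∑ y ∈ dyadicPoints d (i + 1), ENNReal.ofReal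
            |sampleMean (fluctuation η (ψ ⁻¹' {g}) (dyadicMap (i + 1) ⁻¹' {y})) N x|) := by
        refine Finset.sum_le_sum fun g _ => ?_
        have h₁ := hfin g fun n => Measure.dirac (x n).2
        have h₂ := hfin g fun n => η (x n).1
        refine (hT.wasserstein_le J _ _ (by rw [cellMean_univ, cellMean_univ])).trans_eq ?_
        rw [cellMean_univ]
        congr 1
        refine Finset.sum_congr rfl fun i _ => ?_
        congr 1
        refine Finset.sum_congr rfl fun y _ => ?_
        exact absDiff_cellMean ψ hN x g η (hT.measurable _ (measurableSet_singleton y))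
    _ = ENNReal.ofReal (cellBound η ψ G J N x) := by
        rw [Finset.sum_add_distrib, ← Finset.mul_sum, sum_cellMass ψ hN x hG, mul_one, cellBound,
          ENNReal.ofReal_add (by positivity) (by positivity), ENNReal.ofReal_mul two_pos.le,
          ENNReal.ofReal_ofNat, Finset.sum_comm, ENNReal.ofReal_sum_of_nonneg fun i _ => by
            positivity]
        congr 1
        refine Finset.sum_congr rfl fun i _ => ?_
        rw [← Finset.mul_sum, ENNReal.ofReal_mul (p := √d * (1 / 2) ^ i) (by positivity),
          Finset.sum_product,
          ENNReal.ofReal_sum_of_nonneg fun i _ => by positivity]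
        congr 1
        refine Finset.sum_congr rfl fun g _ => ?_
        rw [ENNReal.ofReal_sum_of_nonneg fun i _ => by positivity]

variable {Ω : Type*} [MeasurableSpace Ω] {P : Measure Ω} [IsProbabilityMeasure P]
  {π : Measure (unitCube d × unitCube d)}
  {X : ℕ → Ω → unitCube d × unitCube d}
  {η : Kernel (unitCube d) (unitCube d)} [IsMarkovKernel η]
  {ψ : unitCube d → unitCube d}

theorem integrable_abs_sampleMean_fluctuation (hX : IsIIDSample P π X) (hψ : Measurable ψ) (i : ℕ)
    (p : unitCube d × unitCube d) {N : ℕ} (hN : 1 ≤ N) :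
    Integrable (fun ω => |sampleMean (fluctuation η (ψ ⁻¹' {p.1}) (dyadicMap i ⁻¹' {p.2})) N
      fun n => X n ω|) P :=
  integrable_abs_sampleMean hX (measurable_fluctuation η (hψ (measurableSet_singleton _))
    ((isRefiningScheme_dyadicMap d).measurable i (measurableSet_singleton _)))
    (abs_fluctuation_le η _ _) hN

theorem integrable_cellBound (hX : IsIIDSample P π X) (hψ : Measurable ψ)
    (G : Finset (unitCube d)) (J : ℕ) {N : ℕ} (hN : 1 ≤ N) :
    Integrable (fun ω => cellBound η ψ G J N fun n => X n ω) P := by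
  unfold cellBound
  refine (integrable_const _).add (integrable_finsetSum _ fun i _ => ?_)
  exact (integrable_finsetSum _ fun p _ =>
    integrable_abs_sampleMean_fluctuation hX hψ (i + 1) p hN).const_mul _

theorem integral_cellBound_le [IsProbabilityMeasure π] (hX : IsIIDSample P π X) (hψ : Measurable ψ)
    {G : Finset (unitCube d)} (J : ℕ) {N : ℕ} (hN : 1 ≤ N)
    (hη : ∀ g (Q : Set (unitCube d)), MeasurableSet Q → MatchesOn π η (ψ ⁻¹' {g}) Q)
    {k : ℕ} (hcard : G.card ≤ k ^ d) :
    ∫ ω, cellBound η ψ G J N (fun n => X n ω) ∂P ≤ 2 * (√d * (1 / 2) ^ J)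
      + 2 * √d * ∑ i ∈ Finset.range J,
        (1 / 2 : ℝ) ^ i * √((k ^ d * 2 ^ ((i + 1) * d) : ℝ) / N) := by
  have hT := isRefiningScheme_dyadicMap d
  have hint := fun i p => integrable_abs_sampleMean_fluctuation (η := η) hX hψ i p hN
  unfold cellBound
  rw [integral_add (integrable_const _) (integrable_finsetSum _ fun i _ =>
    (integrable_finsetSum _ fun p _ => hint (i + 1) p).const_mul _), integral_finsetSum _ fun i _ =>
    (integrable_finsetSum _ fun p _ => hint (i + 1) p).const_mul _, Finset.mul_sum]
  simp only [integral_const, probReal_univ, one_smul]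
  gcongr with i _
  rw [integral_const_mul, integral_finsetSum _ fun p _ => hint (i + 1) p]
  have hmψ : ∀ g, MeasurableSet (ψ ⁻¹' {g}) := fun g => hψ (measurableSet_singleton g)
  have hmT : ∀ y, MeasurableSet (dyadicMap (d := d) (i + 1) ⁻¹' {y}) := fun y =>
    hT.measurable _ (measurableSet_singleton y)
  have hsum : ∑ p ∈ G ×ˢ dyadicPoints d (i + 1),
      2 * π.real ((ψ ⁻¹' {p.1}) ×ˢ (dyadicMap (i + 1) ⁻¹' {p.2})) ≤ 2 := by
    rw [← Finset.mul_sum]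
    have e : ∀ p : unitCube d × unitCube d, (ψ ⁻¹' {p.1}) ×ˢ (dyadicMap (i + 1) ⁻¹' {p.2})
        = Prod.map ψ (dyadicMap (i + 1)) ⁻¹' {p} := fun p => by
      rw [← Set.singleton_prod_singleton, Set.preimage_prod_map_prod]
    simp only [e]
    rw [sum_measureReal_preimage_singleton _ fun p _ => by
      rw [← e]
      exact (hmψ p.1).prod (hmT p.2)]
    have : π.real (Prod.map ψ (dyadicMap (i + 1)) ⁻¹' ↑(G ×ˢ dyadicPoints d (i + 1))) ≤ 1 :=
      measureReal_le_one
    linarith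
  have hmain := sum_integral_abs_sampleMean_le hX (G ×ˢ dyadicPoints d (i + 1))
    (h := fun p => fluctuation η (ψ ⁻¹' {p.1}) (dyadicMap (i + 1) ⁻¹' {p.2}))
    (fun p => measurable_fluctuation η (hmψ p.1) (hmT p.2))
    (fun p => abs_fluctuation_le η _ _)
    (fun p => integral_fluctuation (hmψ p.1) (hmT p.2) (hη p.1 _ (hmT p.2)))
    (fun p => integral_fluctuation_sq_le (hmψ p.1) (hmT p.2) (hη p.1 _ (hmT p.2))) hsum hN
  have hcard' : ((G ×ˢ dyadicPoints d (i + 1)).card : ℝ) ≤ k ^ d * 2 ^ ((i + 1) * d) := by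
    rw [Finset.card_product]
    exact_mod_cast Nat.mul_le_mul hcard (card_dyadicPoints_le d (i + 1))
  have hsqrt : √(2 * ((G ×ˢ dyadicPoints d (i + 1)).card : ℝ) / N)
      ≤ 2 * √((k ^ d * 2 ^ ((i + 1) * d) : ℝ) / N) := by
    rw [show (2 : ℝ) * √((k ^ d * 2 ^ ((i + 1) * d) : ℝ) / N)
      = √(2 ^ 2 * ((k ^ d * 2 ^ ((i + 1) * d) : ℝ) / N)) by
        rw [Real.sqrt_mul (by norm_num), Real.sqrt_sq two_pos.le], mul_div_assoc]
    gcongr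
    norm_num
  calc √d * (1 / 2) ^ i * _ ≤ √d * (1 / 2) ^ i * (2 * √((k ^ d * 2 ^ ((i + 1) * d) : ℝ) / N)) := by
        gcongr
        exact hmain.trans hsqrt
    _ = _ := by ring

end CellBound

/-! ### The adapted empirical measure of a fixed sequence -/

section Empirical

variable {d : ℕ} {φ : unitCube d → unitCube d} {N : ℕ} {x : ℕ → unitCube d × unitCube d}

theorem isProbabilityMeasure_inv_smul_sum {β : Type*} [MeasurableSpace β] (hN : 1 ≤ N)
    (μ : ℕ → Measure β) [∀ n, IsProbabilityMeasure (μ n)] :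
    IsProbabilityMeasure ((N : ℝ≥0∞)⁻¹ • ∑ n ∈ Finset.range N, μ n) := ⟨by
  simp only [Measure.smul_apply, Measure.finsetSum_apply, measure_univ, Finset.sum_const,
    Finset.card_range, nsmul_eq_mul, mul_one, smul_eq_mul]
  exact ENNReal.inv_mul_cancel (by exact_mod_cast (by omega : N ≠ 0)) (ENNReal.natCast_ne_top _)⟩

theorem isProbabilityMeasure_adaptedEmpirical (hN : 1 ≤ N) :
    IsProbabilityMeasure (adaptedEmpirical φ N x) :=
  isProbabilityMeasure_inv_smul_sum hN _

theorem adaptedEmpirical_fst : (adaptedEmpirical φ N x).fst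
    = (N : ℝ≥0∞)⁻¹ • ∑ n ∈ Finset.range N, Measure.dirac (φ (x n).1) := by
  ext s hs
  rw [Measure.fst_apply hs]
  simp [adaptedEmpirical, Measure.finsetSum_apply, hs, measurable_fst hs, Set.indicator]
  rfl

theorem adaptedEmpirical_snd : (adaptedEmpirical φ N x).snd
    = (N : ℝ≥0∞)⁻¹ • ∑ n ∈ Finset.range N, Measure.dirac (φ (x n).2) := by
  ext s hs
  rw [Measure.snd_apply hs]
  simp [adaptedEmpirical, Measure.finsetSum_apply, hs, measurable_snd hs, Set.indicator]
  rfl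

theorem lintegral_adaptedEmpirical_fst (f : unitCube d → ℝ≥0∞) :
    ∫⁻ y, f y ∂(adaptedEmpirical φ N x).fst
      = (N : ℝ≥0∞)⁻¹ * ∑ n ∈ Finset.range N, f (φ (x n).1) := by
  rw [adaptedEmpirical_fst, lintegral_smul_measure, lintegral_finsetSum_measure, smul_eq_mul]
  simp

/-- The disintegration of the adapted empirical measure is explicit: at a centre `g` it is the
normalized restriction of the sample to the cell of `g`. -/
theorem cellMass_smul_condKernel (hN : 1 ≤ N) (g : unitCube d) :
    cellMass φ N x g • (adaptedEmpirical φ N x).condKernel g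
      = cellMean φ N x g fun n => Measure.dirac (φ (x n).2) := by
  classical
  have hfst : (adaptedEmpirical φ N x).fst {g} = cellMass φ N x g := by
    rw [adaptedEmpirical_fst, cellMass, Measure.smul_apply, Measure.finsetSum_apply, smul_eq_mul,
      Finset.card_filter]
    simp [Set.indicator]
  ext s hs
  rcases eq_or_ne (cellMass φ N x g) 0 with h0 | h0
  · have : (cellMean φ N x g fun n => Measure.dirac (φ (x n).2)) Set.univ = 0 := by
      rw [cellMean_univ, h0]
    rw [h0, zero_smul, Measure.measure_univ_eq_zero.1 this]
  · rw [Measure.smul_apply, Measure.condKernel_apply_of_ne_zero (by rwa [hfst]), hfst, smul_eq_mul,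
      ← mul_assoc, ENNReal.mul_inv_cancel h0 (cellMass_ne_top φ hN x g), one_mul, cellMean,
      adaptedEmpirical, Measure.smul_apply, Measure.smul_apply, Measure.finsetSum_apply,
      Measure.finsetSum_apply, Finset.sum_filter]
    congr 1
    refine Finset.sum_congr rfl fun n _ => ?_
    rw [Measure.dirac_apply' _ ((measurableSet_singleton g).prod hs)]
    by_cases h₁ : φ (x n).1 = g <;> by_cases h₂ : φ (x n).2 ∈ s <;> simp [h₁, h₂, hs]

theorem map_cellMean (hφ : Measurable φ) (ψ : unitCube d → unitCube d) (g : unitCube d) :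
    (cellMean ψ N x g fun n => Measure.dirac (x n).2).map φ
      = cellMean ψ N x g fun n => Measure.dirac (φ (x n).2) := by
  rw [cellMean, cellMean, Measure.map_smul, ← Measure.mapₗ_apply_of_measurable hφ, map_sum]
  simp only [Measure.mapₗ_apply_of_measurable hφ, Measure.map_dirac' hφ]

variable {κ : Kernel (unitCube d) (unitCube d)} [IsMarkovKernel κ] {L : ℝ≥0} {δ : ℝ≥0∞}

/-- The distance, in a cell, between the adapted empirical kernel and a Lipschitz kernel. -/
theorem cellMass_mul_wasserstein_le (hκ : ∀ x y, wasserstein (κ x) (κ y) ≤ L * edist x y)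
    (hφ : Measurable φ) (hδ : ∀ y, edist (φ y) y ≤ δ) (hN : 1 ≤ N) (g : unitCube d) :
    cellMass φ N x g * wasserstein ((adaptedEmpirical φ N x).condKernel g) (κ g)
      ≤ cellMass φ N x g * ((L + 1) * δ)
        + wasserstein (cellMean φ N x g fun n => Measure.dirac (x n).2)
          (cellMean φ N x g fun n => κ (x n).1) := by
  classical
  have hfin : ∀ (μ : ℕ → Measure (unitCube d)) [∀ n, IsProbabilityMeasure (μ n)],
      IsFiniteMeasure (cellMean φ N x g μ) := fun μ _ => ⟨by
    rw [cellMean_univ]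
    exact (cellMass_ne_top φ hN x g).lt_top⟩
  have f₁ := hfin fun n => Measure.dirac (φ (x n).2)
  have f₂ := hfin fun n => Measure.dirac (x n).2
  have f₃ := hfin fun n => κ (x n).1
  -- rounding of the second coordinate
  have h₁ : wasserstein (cellMean φ N x g fun n => Measure.dirac (φ (x n).2))
      (cellMean φ N x g fun n => Measure.dirac (x n).2) ≤ δ * cellMass φ N x g := by
    rw [wasserstein_comm, ← map_cellMean hφ, ← cellMean_univ φ N x g fun n => Measure.dirac (x n).2]
    exact wasserstein_self_map_le _ hφ hδ
  -- rounding of the first coordinate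
  have h₂ : wasserstein (cellMean φ N x g fun n => κ (x n).1) (cellMean φ N x g fun _ => κ g)
      ≤ L * δ * cellMass φ N x g := by
    refine (wasserstein_smul_le (ENNReal.inv_ne_top.2
      (by exact_mod_cast (by omega : N ≠ 0))) _ _).trans ?_
    rw [cellMass, mul_left_comm]
    gcongr
    refine (wasserstein_sum_le _ _ _).trans ((Finset.sum_le_card_nsmul _ _ (L * δ) ?_).trans_eq ?_)
    · intro n hn
      refine (hκ _ _).trans ?_
      simp only [Finset.mem_filter] at hn
      rw [← hn.2, edist_comm]
      gcongr
      exact hδ _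
    · rw [nsmul_eq_mul, mul_comm]
  refine (mul_wasserstein_le (cellMass_ne_top φ hN x g) _ _).trans ?_
  rw [cellMass_smul_condKernel hN, ← cellMean_const φ N x g (κ g)]
  calc _ ≤ _ := wasserstein_triangle _ (cellMean φ N x g fun n => Measure.dirac (x n).2) _
    _ ≤ δ * cellMass φ N x g
          + (wasserstein (cellMean φ N x g fun n => Measure.dirac (x n).2)
              (cellMean φ N x g fun n => κ (x n).1) + L * δ * cellMass φ N x g) := by
        refine add_le_add h₁ ((wasserstein_triangle _
          (cellMean φ N x g fun n => κ (x n).1) _).trans ?_)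
        gcongr
    _ = _ := by ring

theorem mean_wasserstein_condKernel_le (hκ : ∀ x y, wasserstein (κ x) (κ y) ≤ L * edist x y)
    (hφ : Measurable φ) (hδ : ∀ y, edist (φ y) y ≤ δ) {G : Finset (unitCube d)}
    (hG : ∀ y, φ y ∈ G) (J : ℕ) (hN : 1 ≤ N) :
    (N : ℝ≥0∞)⁻¹ * ∑ n ∈ Finset.range N,
        wasserstein ((adaptedEmpirical φ N x).condKernel (φ (x n).1)) (κ (x n).1)
      ≤ (2 * L + 1) * δ + ENNReal.ofReal (cellBound κ φ G J N x) := by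
  have hN0 : (N : ℝ≥0∞) ≠ 0 := by exact_mod_cast (by omega : N ≠ 0)
  calc _ ≤ (N : ℝ≥0∞)⁻¹ * ∑ n ∈ Finset.range N,
          (wasserstein ((adaptedEmpirical φ N x).condKernel (φ (x n).1)) (κ (φ (x n).1))
            + L * δ) := by
        gcongr with n _
        refine (wasserstein_triangle _ (κ (φ (x n).1)) _).trans ?_
        gcongr
        refine (hκ _ _).trans ?_
        gcongr
        exact hδ _
    _ = (∑ g ∈ G, cellMass φ N x g *
          wasserstein ((adaptedEmpirical φ N x).condKernel g) (κ g)) + L * δ := by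
        rw [sum_cellMass_mul φ N x
          (fun g => wasserstein ((adaptedEmpirical φ N x).condKernel g) (κ g)) hG,
          Finset.sum_add_distrib, mul_add]
        simp only [Finset.sum_const, Finset.card_range, nsmul_eq_mul]
        rw [← mul_assoc (N : ℝ≥0∞)⁻¹ (N : ℝ≥0∞), ENNReal.inv_mul_cancel hN0
          (ENNReal.natCast_ne_top _), one_mul]
    _ ≤ (∑ g ∈ G, (cellMass φ N x g * ((L + 1) * δ)
          + wasserstein (cellMean φ N x g fun n => Measure.dirac (x n).2)
          (cellMean φ N x g fun n => κ (x n).1))) + L * δ := by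
        gcongr with g _
        exact cellMass_mul_wasserstein_le hκ hφ hδ hN g
    _ = (2 * L + 1) * δ + ∑ g ∈ G, wasserstein (cellMean φ N x g fun n => Measure.dirac (x n).2)
          (cellMean φ N x g fun n => κ (x n).1) := by
        rw [Finset.sum_add_distrib, ← Finset.sum_mul, sum_cellMass φ hN x hG]
        ring
    _ ≤ _ := by
        gcongr
        exact sum_wasserstein_cellMean_le κ hG J hN x

/-- The second marginal: here the partition consists of one cell, and the kernel is constant. -/
theorem wasserstein_adaptedEmpirical_snd_le (hφ : Measurable φ) (hδ : ∀ y, edist (φ y) y ≤ δ)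
    (ν : Measure (unitCube d)) [IsProbabilityMeasure ν] (c : unitCube d) (J : ℕ) (hN : 1 ≤ N) :
    wasserstein (adaptedEmpirical φ N x).snd ν
      ≤ δ + ENNReal.ofReal (cellBound (Kernel.const _ ν) (fun _ => c) {c} J N x) := by
  have hN0 : (N : ℝ≥0∞) ≠ 0 := by exact_mod_cast (by omega : N ≠ 0)
  have hB := sum_wasserstein_cellMean_le (Kernel.const (unitCube d) ν) (ψ := fun _ => c) (G := {c})
    (fun _ => Finset.mem_singleton_self c) J hN x
  have hmass : cellMass (fun _ => c) N x c = 1 := by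
    simp [cellMass, ENNReal.inv_mul_cancel hN0 (ENNReal.natCast_ne_top _)]
  simp only [Finset.sum_singleton, Kernel.const_apply, cellMean_const, hmass, one_smul] at hB
  have e : (adaptedEmpirical φ N x).snd
      = (cellMean (fun _ => c) N x c fun n => Measure.dirac (x n).2).map φ := by
    rw [map_cellMean hφ, adaptedEmpirical_snd, cellMean]
    simp only [Finset.filter_true]
  have hfin : IsFiniteMeasure (cellMean (fun _ => c) N x c fun n => Measure.dirac (x n).2) := ⟨by
    rw [cellMean_univ, hmass]
    exact ENNReal.one_lt_top⟩
  have h₁ := wasserstein_self_map_le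
    (cellMean (fun _ => c) N x c fun n => Measure.dirac (x n).2) hφ hδ
  rw [cellMean_univ, hmass, mul_one, ← e, wasserstein_comm] at h₁
  exact (wasserstein_triangle _ _ _).trans (add_le_add h₁ hB)

end Empirical

/-! ### Deterministic bounds for the errors -/

/-- Distances of extended nonnegative real numbers, in terms of real numbers. -/
theorem abs_toReal_sub_le {a b : ℝ≥0∞} {c : ℝ} (ha : a ≠ ∞) (hb : b ≠ ∞) (hc : 0 ≤ c)
    (hab : a ≤ b + ENNReal.ofReal c) (hba : b ≤ a + ENNReal.ofReal c) :
    |a.toReal - b.toReal| ≤ c := by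
  have h₁ := ENNReal.toReal_mono (ENNReal.add_ne_top.2 ⟨hb, ENNReal.ofReal_ne_top⟩) hab
  have h₂ := ENNReal.toReal_mono (ENNReal.add_ne_top.2 ⟨ha, ENNReal.ofReal_ne_top⟩) hba
  rw [ENNReal.toReal_add hb ENNReal.ofReal_ne_top, ENNReal.toReal_ofReal hc] at h₁
  rw [ENNReal.toReal_add ha ENNReal.ofReal_ne_top, ENNReal.toReal_ofReal hc] at h₂
  rw [abs_le]
  constructor <;> linarith

section Cube

variable {d : ℕ}

theorem wasserstein_le_sqrt (μ ν : Measure (unitCube d)) [IsProbabilityMeasure μ]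
    [IsProbabilityMeasure ν] : wasserstein μ ν ≤ ENNReal.ofReal √d :=
  wasserstein_le_of_edist_le μ ν edist_unitCube_le_sqrt

theorem wasserstein_ne_top (μ ν : Measure (unitCube d)) [IsProbabilityMeasure μ]
    [IsProbabilityMeasure ν] : wasserstein μ ν ≠ ∞ :=
  ne_top_of_le_ne_top ENNReal.ofReal_ne_top (wasserstein_le_sqrt μ ν)

theorem lintegral_edist_ne_top (μ : Measure (unitCube d)) [IsProbabilityMeasure μ] :
    ∫⁻ y, ∫⁻ z, edist y z ∂μ ∂μ ≠ ∞ := by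
  refine ne_top_of_le_ne_top (ENNReal.ofReal_ne_top (r := √d)) ?_
  calc ∫⁻ y, ∫⁻ z, edist y z ∂μ ∂μ ≤ ∫⁻ _, ∫⁻ _, ENNReal.ofReal √d ∂μ ∂μ :=
        lintegral_mono fun y => lintegral_mono fun z => edist_unitCube_le_sqrt y z
    _ = _ := by simp

/-- The mean distance is Lipschitz with constant two. -/
theorem abs_meanDist_sub_le (μ ν : Measure (unitCube d)) [IsProbabilityMeasure μ]
    [IsProbabilityMeasure ν] {c : ℝ} (hc : 0 ≤ c) (h : wasserstein μ ν ≤ ENNReal.ofReal c) :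
    |meanDist μ - meanDist ν| ≤ 2 * c := by
  have e : ENNReal.ofReal (2 * c) = ENNReal.ofReal c + ENNReal.ofReal c := by
    rw [two_mul, ENNReal.ofReal_add hc hc]
  refine abs_toReal_sub_le (lintegral_edist_ne_top μ) (lintegral_edist_ne_top ν) (by positivity)
    ?_ ?_
  · rw [e]
    exact (lintegral_edist_le_add_wasserstein μ ν).trans (by gcongr)
  · rw [e]
    refine (lintegral_edist_le_add_wasserstein ν μ).trans ?_
    rw [wasserstein_comm ν μ]
    gcongr

theorem numerator_le_meanDist (π : Measure (unitCube d × unitCube d)) [IsProbabilityMeasure π] :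
    numerator π ≤ meanDist π.snd := by
  refine ENNReal.toReal_mono (lintegral_edist_ne_top _) ?_
  have hm : Measurable fun y : unitCube d => ∫⁻ z, edist y z ∂π.snd :=
    measurable_edist.lintegral_prod_right'
  calc ∫⁻ x, wasserstein (π.condKernel x) π.snd ∂π.fst
      ≤ ∫⁻ x, ∫⁻ y, ∫⁻ z, edist y z ∂π.snd ∂(π.condKernel x) ∂π.fst :=
        lintegral_mono fun x => wasserstein_le_lintegral_lintegral _ _
    _ = ∫⁻ p, ∫⁻ z, edist p.2 z ∂π.snd ∂(π.fst ⊗ₘ π.condKernel) := by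
        rw [Measure.lintegral_compProd (f := fun p : unitCube d × unitCube d =>
          ∫⁻ z, edist p.2 z ∂π.snd) (hm.comp measurable_snd)]
    _ = ∫⁻ y, ∫⁻ z, edist y z ∂π.snd ∂π.snd := by
        rw [π.disintegrate π.condKernel]
        conv_rhs => rw [Measure.snd, lintegral_map (by exact hm) measurable_snd]
        rfl

theorem numerator_nonneg (π : Measure (unitCube d × unitCube d)) [IsProbabilityMeasure π] :
    0 ≤ numerator π := ENNReal.toReal_nonneg

/-- The numerator of the adapted empirical measure is a random variable, since the rounded sample
takes finitely many values. -/
theorem measurable_numerator_adaptedEmpirical {Ω : Type*} [MeasurableSpace Ω]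
    {X : ℕ → Ω → unitCube d × unitCube d} (hX : ∀ n, Measurable (X n))
    {φ : unitCube d → unitCube d} (hφ : Measurable φ) {G : Finset (unitCube d)}
    (hG : ∀ y, φ y ∈ G) (N : ℕ) :
    Measurable fun ω => numerator (adaptedEmpirical φ N fun n => X n ω) := by
  let Φ : Ω → Fin N → G × G := fun ω n =>
    (⟨φ (X n ω).1, hG _⟩, ⟨φ (X n ω).2, hG _⟩)
  have hΦ : Measurable Φ := measurable_pi_lambda _ fun n =>
    ((hφ.comp (measurable_fst.comp (hX n))).subtype_mk).prodMk
      ((hφ.comp (measurable_snd.comp (hX n))).subtype_mk)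
  have hfac : ∀ ω₁ ω₂, Φ ω₁ = Φ ω₂ → adaptedEmpirical φ N (fun n => X n ω₁)
      = adaptedEmpirical φ N fun n => X n ω₂ := fun ω₁ ω₂ h => by
    unfold adaptedEmpirical
    congr 1
    refine Finset.sum_congr rfl fun n hn => ?_
    have h' := congrFun h ⟨n, Finset.mem_range.1 hn⟩
    simp only [Φ, Prod.mk.injEq, Subtype.mk.injEq] at h'
    rw [h'.1, h'.2]
  have hfac' : ∀ ω₁ ω₂, Φ ω₁ = Φ ω₂ → numerator (adaptedEmpirical φ N fun n => X n ω₁)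
      = numerator (adaptedEmpirical φ N fun n => X n ω₂) := fun ω₁ ω₂ h => by
    simp only [hfac ω₁ ω₂ h]
  have e : (fun ω => numerator (adaptedEmpirical φ N fun n => X n ω))
      = (Function.extend Φ (fun ω => numerator (adaptedEmpirical φ N fun n => X n ω)) 0) ∘ Φ := by
    funext ω
    exact (Function.FactorsThrough.extend_apply (fun ω₁ ω₂ h => hfac' ω₁ ω₂ h) _ ω).symm
  have : MeasurableSingletonClass (G × G) := inferInstance
  rw [e]
  exact (measurable_of_countable _).comp hΦ

variable {π : Measure (unitCube d × unitCube d)} [IsProbabilityMeasure π]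
  {κ : Kernel (unitCube d) (unitCube d)} [IsMarkovKernel κ] {L : ℝ≥0}

theorem matchesOn_of_compProd (h : π.fst ⊗ₘ κ = π) {A Q : Set (unitCube d)} (hA : MeasurableSet A)
    (hQ : MeasurableSet Q) : MatchesOn π κ A Q := by
  rw [MatchesOn, ← Measure.compProd_apply_prod hA hQ, h]

theorem matchesOn_const {Q : Set (unitCube d)} (hQ : MeasurableSet Q) {A : Set (unitCube d)}
    (hA : A = ∅ ∨ A = Set.univ) : MatchesOn π (Kernel.const _ π.snd) A Q := by
  rcases hA with rfl | rfl
  · simp [MatchesOn]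
  · simp [MatchesOn, Measure.snd_apply hQ, Set.univ_prod]

theorem wasserstein_kernel_le (hκ : ∀ x y, wasserstein (κ x) (κ y) ≤ L * edist x y)
    (ν : Measure (unitCube d)) [IsProbabilityMeasure ν] (x y : unitCube d) :
    wasserstein (κ x) ν ≤ wasserstein (κ y) ν + L * edist x y := by
  rw [add_comm]
  exact (wasserstein_triangle _ (κ y) _).trans (add_le_add (hκ x y) le_rfl)

theorem measurable_wasserstein_kernel (hκ : ∀ x y, wasserstein (κ x) (κ y) ≤ L * edist x y)
    (ν : Measure (unitCube d)) [IsProbabilityMeasure ν] :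
    Measurable fun x => (wasserstein (κ x) ν).toReal := by
  refine (LipschitzWith.of_dist_le_mul (K := L) fun x y => ?_).continuous.measurable
  have e : ENNReal.ofReal (L * dist x y) = L * edist x y := by
    rw [ENNReal.ofReal_mul L.coe_nonneg, ENNReal.ofReal_coe_nnreal, edist_dist]
  refine abs_toReal_sub_le (wasserstein_ne_top _ _) (wasserstein_ne_top _ _) (by positivity) ?_ ?_
  · rw [e]
    exact wasserstein_kernel_le hκ ν x y
  · rw [e, edist_comm]
    exact wasserstein_kernel_le hκ ν y x

theorem numerator_eq_integral (hπ : π.fst ⊗ₘ κ = π)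
    (hκ : ∀ x y, wasserstein (κ x) (κ y) ≤ L * edist x y) :
    numerator π = ∫ z, (wasserstein (κ z.1) π.snd).toReal ∂π := by
  have h : ∀ᵐ x ∂π.fst, κ x = π.condKernel x := eq_condKernel_of_measure_eq_compProd κ hπ.symm
  have e : ∫ z, (wasserstein (κ z.1) π.snd).toReal ∂π
      = ∫ x, (wasserstein (κ x) π.snd).toReal ∂π.fst := by
    rw [Measure.fst, integral_map measurable_fst.aemeasurable
      (measurable_wasserstein_kernel hκ _).aestronglyMeasurable]
  have hm : Measurable fun x => wasserstein (κ x) π.snd := by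
    have := (measurable_wasserstein_kernel hκ π.snd).ennreal_ofReal
    simpa only [ENNReal.ofReal_toReal (wasserstein_ne_top _ _)] using this
  rw [e, integral_toReal hm.aemeasurable (.of_forall fun x => (wasserstein_ne_top _ _).lt_top),
    numerator]
  congr 1
  refine lintegral_congr_ae ?_
  filter_upwards [h] with x hx
  rw [hx]

/-- The error of the numerator is bounded by the fluctuation of the empirical mean of
`x₁ ↦ W(κ x₁, π₂)`, by the effect of rounding, and by the distances between the sample and its
conditional expectation in the cells of the grid and in the whole cube. -/
theorem abs_numerator_sub_le (hκ : ∀ x y, wasserstein (κ x) (κ y) ≤ L * edist x y)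
    {φ : unitCube d → unitCube d} (hφ : Measurable φ) {δ : ℝ} (hδ0 : 0 ≤ δ)
    (hδ : ∀ y, edist (φ y) y ≤ ENNReal.ofReal δ)
    {G : Finset (unitCube d)} (hG : ∀ y, φ y ∈ G) (c : unitCube d) (J : ℕ) {N : ℕ} (hN : 1 ≤ N)
    (x : ℕ → unitCube d × unitCube d) :
    |numerator (adaptedEmpirical φ N x) - numerator π|
      ≤ |sampleMean (fun z => (wasserstein (κ z.1) π.snd).toReal - numerator π) N x|
        + ((2 * L + 2) * δ + cellBound κ φ G J N x
          + cellBound (Kernel.const _ π.snd) (fun _ => c) {c} J N x) := by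
  have hN' : (0 : ℝ) < N := by exact_mod_cast hN
  have hN0 : (N : ℝ≥0∞) ≠ 0 := by exact_mod_cast (by omega : N ≠ 0)
  have hprob : IsProbabilityMeasure (adaptedEmpirical φ N x) :=
    isProbabilityMeasure_adaptedEmpirical hN
  set ρ := adaptedEmpirical φ N x
  set B₁ := cellBound κ φ G J N x
  set B₂ := cellBound (Kernel.const _ π.snd) (fun _ => c) {c} J N x
  have hB₁0 : 0 ≤ B₁ := cellBound_nonneg _ _ _ _ _ _
  have hB₂0 : 0 ≤ B₂ := cellBound_nonneg _ _ _ _ _ _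
  set a := (N : ℝ≥0∞)⁻¹ * ∑ n ∈ Finset.range N, wasserstein (ρ.condKernel (φ (x n).1)) ρ.snd
  set b := (N : ℝ≥0∞)⁻¹ * ∑ n ∈ Finset.range N, wasserstein (κ (x n).1) π.snd with hb
  have ha : numerator ρ = a.toReal := by
    rw [numerator, lintegral_adaptedEmpirical_fst]
  have hbreal : b.toReal = sampleMean (fun z => (wasserstein (κ z.1) π.snd).toReal) N x := by
    rw [hb, ENNReal.toReal_mul, ENNReal.toReal_inv, ENNReal.toReal_natCast,
      ENNReal.toReal_sum fun n _ => wasserstein_ne_top _ _, sampleMean]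
  have hsplit : b.toReal - numerator π
      = sampleMean (fun z => (wasserstein (κ z.1) π.snd).toReal - numerator π) N x := by
    rw [hbreal, sampleMean, sampleMean, Finset.sum_sub_distrib, Finset.sum_const,
      Finset.card_range, nsmul_eq_mul, mul_sub, ← mul_assoc, inv_mul_cancel₀ hN'.ne', one_mul]
  have hE₁ : (N : ℝ≥0∞)⁻¹ * ∑ n ∈ Finset.range N,
      wasserstein (ρ.condKernel (φ (x n).1)) (κ (x n).1)
        ≤ (2 * L + 1) * ENNReal.ofReal δ + ENNReal.ofReal B₁ :=
    mean_wasserstein_condKernel_le hκ hφ hδ hG J hN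
  have hE₂ : wasserstein ρ.snd π.snd ≤ ENNReal.ofReal δ + ENNReal.ofReal B₂ :=
    wasserstein_adaptedEmpirical_snd_le hφ hδ π.snd c J hN
  have hE : ENNReal.ofReal ((2 * L + 2) * δ + B₁ + B₂)
      = ((2 * L + 1) * ENNReal.ofReal δ + ENNReal.ofReal B₁)
        + (ENNReal.ofReal δ + ENNReal.ofReal B₂) := by
    rw [ENNReal.ofReal_add (by positivity) hB₂0, ENNReal.ofReal_add (by positivity) hB₁0,
      ENNReal.ofReal_mul (by positivity), ENNReal.ofReal_add (by positivity) two_pos.le,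
      ENNReal.ofReal_mul two_pos.le, ENNReal.ofReal_coe_nnreal, ENNReal.ofReal_ofNat]
    ring
  -- a bound between averages, from a bound between the terms
  have havg : ∀ (s t u : ℕ → ℝ≥0∞) (v : ℝ≥0∞), (∀ n, s n ≤ t n + (u n + v)) →
      (N : ℝ≥0∞)⁻¹ * ∑ n ∈ Finset.range N, s n ≤ (N : ℝ≥0∞)⁻¹ * ∑ n ∈ Finset.range N, t n
        + ((N : ℝ≥0∞)⁻¹ * ∑ n ∈ Finset.range N, u n + v) := fun s t u v h => by
    calc _ ≤ (N : ℝ≥0∞)⁻¹ * ∑ n ∈ Finset.range N, (t n + (u n + v)) := by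
          gcongr with n _
          exact h n
      _ = _ := by
          simp only [Finset.sum_add_distrib, mul_add, Finset.sum_const, Finset.card_range,
            nsmul_eq_mul]
          rw [← mul_assoc (N : ℝ≥0∞)⁻¹ (N : ℝ≥0∞), ENNReal.inv_mul_cancel hN0
            (ENNReal.natCast_ne_top _), one_mul]
  have hab : a ≤ b + ENNReal.ofReal ((2 * L + 2) * δ + B₁ + B₂) := by
    rw [hE]
    refine (havg _ _ (fun n => wasserstein (ρ.condKernel (φ (x n).1)) (κ (x n).1))
      (wasserstein ρ.snd π.snd) fun n => ?_).trans (by gcongr)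
    calc _ ≤ _ := wasserstein_triangle _ (κ (x n).1) _
      _ ≤ wasserstein (ρ.condKernel (φ (x n).1)) (κ (x n).1)
          + (wasserstein (κ (x n).1) π.snd + wasserstein π.snd ρ.snd) := by
        gcongr
        exact wasserstein_triangle _ _ _
      _ = _ := by
        rw [wasserstein_comm π.snd]
        ring
  have hba : b ≤ a + ENNReal.ofReal ((2 * L + 2) * δ + B₁ + B₂) := by
    rw [hE]
    refine (havg _ _ (fun n => wasserstein (ρ.condKernel (φ (x n).1)) (κ (x n).1))
      (wasserstein ρ.snd π.snd) fun n => ?_).trans (by gcongr)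
    calc _ ≤ _ := wasserstein_triangle _ (ρ.condKernel (φ (x n).1)) _
      _ ≤ wasserstein (κ (x n).1) (ρ.condKernel (φ (x n).1))
          + (wasserstein (ρ.condKernel (φ (x n).1)) ρ.snd + wasserstein ρ.snd π.snd) := by
        gcongr
        exact wasserstein_triangle _ _ _
      _ = _ := by
        rw [wasserstein_comm (κ (x n).1)]
        ring
  have hbtop : b ≠ ∞ := ENNReal.mul_ne_top (ENNReal.inv_ne_top.2 hN0)
    (ENNReal.sum_ne_top.2 fun n _ => wasserstein_ne_top _ _)
  have hatop : a ≠ ∞ := ne_top_of_le_ne_top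
    (ENNReal.add_ne_top.2 ⟨hbtop, ENNReal.ofReal_ne_top⟩) hab
  have hfin := abs_toReal_sub_le hatop hbtop (by positivity) hab hba
  rw [ha, ← hsplit]
  calc |a.toReal - numerator π| ≤ |a.toReal - b.toReal| + |b.toReal - numerator π| :=
        abs_sub_le _ _ _
    _ ≤ _ := by linarith

theorem abs_meanDist_adaptedEmpirical_sub_le {φ : unitCube d → unitCube d}
    (hφ : Measurable φ) {δ : ℝ} (hδ0 : 0 ≤ δ) (hδ : ∀ y, edist (φ y) y ≤ ENNReal.ofReal δ)
    (c : unitCube d) (J : ℕ) {N : ℕ} (hN : 1 ≤ N) (x : ℕ → unitCube d × unitCube d) :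
    |meanDist (adaptedEmpirical φ N x).snd - meanDist π.snd|
      ≤ 2 * (δ + cellBound (Kernel.const _ π.snd) (fun _ => c) {c} J N x) := by
  have hprob : IsProbabilityMeasure (adaptedEmpirical φ N x) :=
    isProbabilityMeasure_adaptedEmpirical hN
  have h0 := cellBound_nonneg (Kernel.const _ π.snd) (fun _ => c) {c} J N x
  refine abs_meanDist_sub_le _ _ (by positivity) ?_
  rw [ENNReal.ofReal_add hδ0 h0]
  exact wasserstein_adaptedEmpirical_snd_le hφ hδ π.snd c J hN

end Cube

/-! ### The expected errors and their rate -/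

/-- The random variable that bounds the errors of the numerator and of the mean distance, with its
expectation. -/
theorem exists_error_bound {d : ℕ} (hd : 1 ≤ d) {L : ℝ≥0} {Ω : Type*} [MeasurableSpace Ω]
    {P : Measure Ω} [IsProbabilityMeasure P] {π : Measure (unitCube d × unitCube d)}
    [IsProbabilityMeasure π] {X : ℕ → Ω → unitCube d × unitCube d} (hX : IsIIDSample P π X)
    (hL : HasLipschitzKernel L π) {N : ℕ} (hN : 1 ≤ N) {φ : unitCube d → unitCube d}
    (hφ : IsAdaptedCenterMap N φ) :
    ∃ B : Ω → ℝ, Integrable B P ∧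
      ∫ ω, B ω ∂P ≤ √d * (26 + 8 * L + 20 * 4 ^ d) * rate d N ∧
      (∀ ω, |numerator (adaptedEmpirical φ N fun n => X n ω) - numerator π| ≤ B ω) ∧
      ∀ ω, |meanDist (adaptedEmpirical φ N fun n => X n ω).snd - meanDist π.snd| ≤ 2 * B ω := by
  obtain ⟨κ, hκM, hπ, hκ⟩ := hL
  obtain ⟨k, hk, hkN, hc⟩ := hφ
  obtain ⟨G, hG, hcard⟩ := hc.exists_finset
  set J := Nat.clog 2 k
  set c : unitCube d := Classical.arbitrary _
  have hr := rate_pos (d := d) hN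
  have hk1 := one_div_le_rate hN hk hkN
  have hscale : (1 / 2 : ℝ) ^ J ≤ 1 / k := by
    rw [div_pow, one_pow]
    refine one_div_le_one_div_of_le (by exact_mod_cast hk) ?_
    exact_mod_cast Nat.le_pow_clog one_lt_two k
  have hsum := sum_scales_le hd hN hk hkN
  set h₀ : unitCube d × unitCube d → ℝ :=
    fun z => (wasserstein (κ z.1) π.snd).toReal - numerator π with hh₀
  have hFm : Measurable fun z : unitCube d × unitCube d => (wasserstein (κ z.1) π.snd).toReal :=
    (measurable_wasserstein_kernel hκ π.snd).comp measurable_fst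
  have hF1 : ∀ z : unitCube d × unitCube d, (wasserstein (κ z.1) π.snd).toReal ≤ √d := fun z =>
    ENNReal.toReal_le_of_le_ofReal (by positivity) (wasserstein_le_sqrt _ _)
  have hF0 : ∀ z : unitCube d × unitCube d, 0 ≤ (wasserstein (κ z.1) π.snd).toReal := fun z =>
    ENNReal.toReal_nonneg
  have hFint : Integrable (fun z : unitCube d × unitCube d =>
      (wasserstein (κ z.1) π.snd).toReal) π :=
    Integrable.of_bound hFm.aestronglyMeasurable √d (.of_forall fun z => by
      rw [Real.norm_eq_abs, abs_of_nonneg (hF0 z)]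
      exact hF1 z)
  have hnum1 : numerator π ≤ √d := by
    rw [numerator_eq_integral hπ hκ]
    calc _ ≤ ∫ _, √d ∂π := integral_mono hFint (integrable_const _) hF1
      _ = √d := by simp
  have hnum0 := numerator_nonneg π
  have hm₀ : Measurable h₀ := hFm.sub_const _
  have hB₀ : ∀ z, |h₀ z| ≤ √d := fun z => by
    rw [abs_le]
    constructor <;> linarith [hF0 z, hF1 z]
  have hmean₀ : ∫ z, h₀ z ∂π = 0 := by
    rw [hh₀, integral_sub hFint (integrable_const _), ← numerator_eq_integral hπ hκ]
    simp
  have hsq₀ : ∫ z, h₀ z ^ 2 ∂π ≤ d := by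
    have hle : ∀ z, h₀ z ^ 2 ≤ d := fun z => by
      rw [← sq_abs, ← Real.sq_sqrt (Nat.cast_nonneg (α := ℝ) d)]
      exact pow_le_pow_left₀ (abs_nonneg _) (hB₀ z) 2
    calc _ ≤ ∫ _, (d : ℝ) ∂π := by
          refine integral_mono ?_ (integrable_const _) hle
          refine Integrable.of_bound (hm₀.pow_const 2).aestronglyMeasurable d
            (.of_forall fun z => ?_)
          rw [Real.norm_eq_abs, abs_of_nonneg (sq_nonneg _)]
          exact hle z
      _ = d := by simp
  have hE₀ : ∫ ω, |sampleMean h₀ N fun n => X n ω| ∂P ≤ √d * (2 * rate d N) := by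
    refine (integral_abs_sampleMean_le hX hm₀ hB₀ hmean₀ hsq₀ hN).trans ?_
    rw [div_eq_mul_one_div, Real.sqrt_mul (Nat.cast_nonneg d)]
    gcongr
    exact inv_sqrt_le_rate hd hN
  have hI₀ : Integrable (fun ω => |sampleMean h₀ N fun n => X n ω|) P :=
    integrable_abs_sampleMean hX hm₀ hB₀ hN
  have hI₁ := integrable_cellBound (η := κ) hX hc.1 G J hN
  have hI₂ := integrable_cellBound (η := Kernel.const (unitCube d) π.snd) hX
    (measurable_const (a := c)) {c} J hN
  have hI₃ : Integrable (fun ω => (2 * (L : ℝ) + 2) * (√d * (1 / k))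
      + cellBound κ φ G J N fun n => X n ω) P := (integrable_const _).add hI₁
  have hI₄ : Integrable (fun ω => (2 * (L : ℝ) + 2) * (√d * (1 / k))
      + cellBound κ φ G J N (fun n => X n ω)
      + cellBound (Kernel.const _ π.snd) (fun _ => c) {c} J N fun n => X n ω) P := hI₃.add hI₂
  have hcell : ∀ {E : ℝ}, E ≤ 2 * (√d * (1 / 2) ^ J) + 2 * √d * ∑ i ∈ Finset.range J,
      (1 / 2 : ℝ) ^ i * √((k ^ d * 2 ^ ((i + 1) * d) : ℝ) / N) →
      E ≤ √d * (8 + 10 * 4 ^ d) * rate d N := fun {E} hE => by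
    calc E ≤ 2 * (√d * (1 / 2) ^ J) + 2 * √d * ∑ i ∈ Finset.range J,
          (1 / 2 : ℝ) ^ i * √((k ^ d * 2 ^ ((i + 1) * d) : ℝ) / N) := hE
      _ ≤ 2 * (√d * (4 * rate d N)) + 2 * √d * (5 * 4 ^ d * rate d N) := by
        gcongr
        exact hscale.trans hk1
      _ = _ := by ring
  have hE₁ := hcell (integral_cellBound_le (η := κ) hX hc.1 J hN
    (fun g Q hQ => matchesOn_of_compProd hπ (hc.1 (measurableSet_singleton g)) hQ) hcard)
  have hE₂ := hcell (integral_cellBound_le (η := Kernel.const (unitCube d) π.snd) (G := {c}) hX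
    (measurable_const (a := c)) J hN (fun g Q hQ => matchesOn_const hQ (by
      by_cases hg : c = g
      · exact Or.inr (Set.preimage_const_of_mem hg)
      · exact Or.inl (Set.preimage_const_of_notMem hg)))
    (by rw [Finset.card_singleton]; exact Nat.one_le_pow _ _ hk))
  refine ⟨fun ω => |sampleMean h₀ N fun n => X n ω| + ((2 * L + 2) * (√d * (1 / k))
      + cellBound κ φ G J N (fun n => X n ω)
      + cellBound (Kernel.const _ π.snd) (fun _ => c) {c} J N fun n => X n ω),
    hI₀.add hI₄, ?_, fun ω =>
      abs_numerator_sub_le hκ hc.1 (by positivity) hc.edist_le hG c J hN _, fun ω => ?_⟩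
  · rw [integral_add hI₀ hI₄, integral_add hI₃ hI₂, integral_add (integrable_const _) hI₁]
    have hconst : ∫ _, (2 * (L : ℝ) + 2) * (√d * (1 / k)) ∂P
        ≤ (2 * L + 2) * (√d * (4 * rate d N)) := by
      simp only [integral_const, probReal_univ, one_smul]
      gcongr
    linarith
  · refine (abs_meanDist_adaptedEmpirical_sub_le hc.1 (by positivity) hc.edist_le c J hN _).trans ?_
    have h₁ := cellBound_nonneg κ φ G J N fun n => X n ω
    have h₂ : 1 * (√d * (1 / k : ℝ)) ≤ (2 * L + 2) * (√d * (1 / k)) := by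
      gcongr
      linarith [L.coe_nonneg]
    have h₃ := abs_nonneg (sampleMean h₀ N fun n => X n ω)
    linarith

/-- A perturbation bound for quotients in `[0,1]`; the denominator `b` of the first one may be
zero. -/
theorem abs_div_sub_div_le {a b a' b' : ℝ} (ha : 0 ≤ a) (hab : a ≤ b) (hb' : 0 < b') :
    |a / b - a' / b'| ≤ (|a - a'| + |b - b'|) / b' := by
  have hq0 : 0 ≤ a / b := div_nonneg ha (ha.trans hab)
  have hq1 : a / b ≤ 1 := div_le_one_of_le₀ hab (ha.trans hab)
  have hq : a / b * b = a := by
    rcases eq_or_ne b 0 with rfl | hb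
    · linarith
    · exact div_mul_cancel₀ a hb
  have e : a / b - a' / b' = ((a - a') - a / b * (b - b')) / b' := by
    rw [mul_sub, hq]
    field_simp
    ring
  rw [e, abs_div, abs_of_pos hb']
  gcongr
  calc |(a - a') - a / b * (b - b')| ≤ |a - a'| + |a / b * (b - b')| := abs_sub _ _
    _ ≤ |a - a'| + 1 * |b - b'| := by
      rw [abs_mul, abs_of_nonneg hq0]
      gcongr
    _ = _ := by rw [one_mul]

end WassersteinCorrelation

theorem mainTheorem6 (d : ℕ) (hd : 1 ≤ d) (L : ℝ≥0) :
    ∃ C : ℝ, 0 < C ∧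
      ∀ (Ω : Type*) [MeasurableSpace Ω] (P : Measure Ω) [IsProbabilityMeasure P]
        (π : Measure (unitCube d × unitCube d)) [IsProbabilityMeasure π]
        (X : ℕ → Ω → unitCube d × unitCube d) (φ : ℕ → unitCube d → unitCube d),
        HasLipschitzKernel L π →
        IsIIDSample P π X →
        (∀ N, 1 ≤ N → IsAdaptedCenterMap N (φ N)) →
        (∀ N, 1 ≤ N →
          Integrable (fun ω =>
            |numerator (adaptedEmpirical (φ N) N fun n => X n ω) - numerator π|) P ∧
          ∫ ω, |numerator (adaptedEmpirical (φ N) N fun n => X n ω) - numerator π| ∂P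
            ≤ C * rate d N) ∧
        (meanDist π.snd ≠ 0 →
          IsBigOP P
            (fun N ω => |wassersteinCorrelation (adaptedEmpirical (φ N) N fun n => X n ω)
              - wassersteinCorrelation π|)
            (rate d)) := by
  have hd0 : (0 : ℝ) < d := by exact_mod_cast hd
  set C : ℝ := √d * (26 + 8 * L + 20 * 4 ^ d)
  have hC : 0 < C := by positivity
  refine ⟨C, hC, fun Ω _ P _ π _ X φ hL hX hφ => ⟨fun N hN => ?_, fun hf => ?_⟩⟩
  · obtain ⟨B, hBI, hBE, hB, -⟩ := exists_error_bound hd hX hL hN (hφ N hN)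
    obtain ⟨k, -, -, hc⟩ := hφ N hN
    obtain ⟨G, hG, -⟩ := hc.exists_finset
    have hm := measurable_numerator_adaptedEmpirical hX.1 hc.1 hG N
    have hI : Integrable (fun ω =>
        |numerator (adaptedEmpirical (φ N) N fun n => X n ω) - numerator π|) P :=
      hBI.mono' (hm.sub_const _).abs.aestronglyMeasurable (.of_forall fun ω => by
        rw [Real.norm_eq_abs, abs_abs]
        exact hB ω)
    exact ⟨hI, (integral_mono hI hBI hB).trans hBE⟩
  · have hf' : 0 < meanDist π.snd := lt_of_le_of_ne ENNReal.toReal_nonneg hf.symm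
    intro ε hε
    refine ⟨3 * C / (meanDist π.snd * ε), by positivity, ?_⟩
    filter_upwards [eventually_ge_atTop 1] with N hN
    obtain ⟨B, hBI, hBE, hB, hB'⟩ := exists_error_bound hd hX hL hN (hφ N hN)
    have hr := rate_pos (d := d) hN
    have hB0 : ∀ ω, 0 ≤ B ω := fun ω => (abs_nonneg _).trans (hB ω)
    have hle : ∀ ω, |wassersteinCorrelation (adaptedEmpirical (φ N) N fun n => X n ω)
        - wassersteinCorrelation π| ≤ 3 * B ω / meanDist π.snd := fun ω => by
      have := isProbabilityMeasure_adaptedEmpirical (φ := φ N) (x := fun n => X n ω) hN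
      refine (abs_div_sub_div_le (numerator_nonneg _) (numerator_le_meanDist _) hf').trans ?_
      gcongr
      linarith [hB ω, hB' ω]
    -- Markov's inequality
    set t : ℝ := 3 * C / (meanDist π.snd * ε) * rate d N with ht
    have ht0 : 0 < t := by positivity
    have hmarkov := mul_meas_ge_le_integral_of_nonneg (μ := P)
      (f := fun ω => 3 * B ω / meanDist π.snd)
      (.of_forall fun ω => div_nonneg (mul_nonneg (by norm_num) (hB0 ω)) hf'.le)
      ((hBI.const_mul 3).div_const _) t
    have hint : ∫ ω, 3 * B ω / meanDist π.snd ∂P ≤ t * ε := by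
      rw [integral_div, integral_const_mul]
      calc _ ≤ 3 * (C * rate d N) / meanDist π.snd := by gcongr
        _ = t * ε := by
          rw [ht]
          field_simp
    have hreal : P.real {ω | t ≤ 3 * B ω / meanDist π.snd} ≤ ε :=
      le_of_mul_le_mul_left (hmarkov.trans hint) ht0
    calc P {ω | t < |(|wassersteinCorrelation (adaptedEmpirical (φ N) N fun n => X n ω)
          - wassersteinCorrelation π|)|} ≤ P {ω | t ≤ 3 * B ω / meanDist π.snd} := by
          refine measure_mono fun ω hω => ?_
          rw [Set.mem_ofPred_eq, abs_abs] at hω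
          exact hω.le.trans (hle ω)
      _ = ENNReal.ofReal (P.real {ω | t ≤ 3 * B ω / meanDist π.snd}) := by
          rw [ofReal_measureReal]
      _ ≤ ENNReal.ofReal ε := ENNReal.ofReal_le_ofReal hreal
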